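/- For a real number $Y$ and a positive integer $D$ let $\omega_Y(D)=\#\{p\le Y: p \text{ prime},\ p\mid D\}$. A Dirichlet character $\chi$ modulo $D$ is called quadratic if $\chi\neq\chi_0$ and $\chi^2=\chi_0$, where $\chi_0$ is the principal character modulo $D$. For a constant $c_0>0$ say that $\chi$ has an exceptional zero if $L(s,\chi)$ has a real zero $\beta>1-c_0/\log D$, and call $c_0$ admissible if, for every modulus $D$, at most one quadratic character modulo $D$ has an exceptional zero. Admissible constants exist. Fix an admissible $c_0$, and let $$V=V_D=\{\chi \bmod D : \chi\ne\chi_0,\ \chi^2=\chi_0,\ \chi\text{ does not have an exceptional zero}\}.$$ For every quadratic $\chi$ the value $L(1,\chi)$ is a positive real number. In the two statements below, $\log\omega_Y(D)$ is read as $0$ if $\omega_Y(D)=0$, and a statement about $V$ is vacuous if $V$ is empty. 1. There is a constant $C>0$, depending only on $c_0$, such that for every modulus $D$ and every real $Y$ with $e\le Y<D$, $$\frac1{\#V}\sum_{\chi\in V}(\log L(1,\chi))^2\le C\left((\log\log D)\bigl(\log\omega_Y(D)+\log\log Y\bigr)+\frac{(\log\log D)^2}{2^{\omega_Y(D)}}\right).$$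 2. There is a constant $c>0$, depending only on $c_0$, such that for every modulus $D$, every real $Y$ with $e\le Y\le D$ and every real $k\ge1$, at least $(1-1/k^2)\,\#V$ of the characters $\chi\in V$ satisfy $$L(1,\chi)\ge(\log D)^{-kc\sqrt{\frac{\log\omega_Y(D)+\log\log Y}{\log\log D}+\frac1{2^{\omega_Y(D)}}}}.$$ -/

import Mathlib

noncomputable section

namespace QuadraticLOne

/-- The number of primes `p ≤ Y` dividing `D`, where `Y` is a real number. -/
def omegaUpTo (Y : ℝ) (D : ℕ) : ℕ :=
  (D.primeFactors.filter fun p : ℕ => (p : ℝ) ≤ Y).card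

/-- A quadratic (that is, real and nonprincipal) Dirichlet character modulo `D`. -/
def IsQuadraticChar {D : ℕ} (χ : DirichletCharacter ℂ D) : Prop :=
  χ ≠ 1 ∧ χ ^ 2 = 1

/-- `L(s, χ)` has a real zero `β > 1 - c₀ / log D`. -/
def HasExceptionalZero (c₀ : ℝ) {D : ℕ} [NeZero D] (χ : DirichletCharacter ℂ D) : Prop :=
  ∃ β : ℝ, 1 - c₀ / Real.log D < β ∧ χ.LFunction (β : ℂ) = 0

/-- The absolute constants that may be used to define exceptional zeros: those `c₀ > 0` for which
every modulus has at most one quadratic character with an exceptional zero. -/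
def IsExceptionalConstant (c₀ : ℝ) : Prop :=
  0 < c₀ ∧ ∀ (D : ℕ) [NeZero D] (χ₁ χ₂ : DirichletCharacter ℂ D),
    IsQuadraticChar χ₁ → IsQuadraticChar χ₂ →
    HasExceptionalZero c₀ χ₁ → HasExceptionalZero c₀ χ₂ → χ₁ = χ₂

/-- The set `V` of quadratic characters modulo `D` without an exceptional zero. -/
def nonExceptional (c₀ : ℝ) (D : ℕ) [NeZero D] : Finset (DirichletCharacter ℂ D) :=
  (Set.toFinite
    {χ : DirichletCharacter ℂ D | IsQuadraticChar χ ∧ ¬ HasExceptionalZero c₀ χ}).toFinset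

/-- `L(1, χ)` as a real number (for quadratic `χ` the complex value is real). -/
def LOne {D : ℕ} [NeZero D] (χ : DirichletCharacter ℂ D) : ℝ :=
  (χ.LFunction 1).re

end QuadraticLOne

end

/-! Let t = ε/(log D)³. For χ in V one has L(1,χ) ≫ 1/log D (`exists_le_LOne`) and L'(s,χ) ≪ (log
D)² near 1, so log L(1+t,χ) and log L(1,χ) differ by at most 1 (`exists_abs_logL_le`). At 1+t the
logarithm is an absolutely convergent series Σ χ(n)w(n) with w ≥ 0.

Its mean square over the group of all real characters modulo D is a sum of nonnegative weights times
averages of χ(mn). Such an average is 0 or 1, and it cannot decrease when D is replaced by a divisor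
D' (`card_mul_sum_logL_sq_le`). Let D' be the product of the odd primes p ≤ Y dividing D. Then log
D' ≤ ω log Y, so nonexceptional characters modulo D' have |log L(1+t,ψ)| ≤ X + O(1) with X = log ω +
log log Y. At most two real characters modulo D' remain, each with |log L(1+t,ψ)| ≪ log log D, and
they carry weight ≪ 2^(-ω), because D' has at least 2^(ω-1) real characters. Since X ≪ log log D +
1, X² is replaced by X log log D. The second statement is Chebyshev's inequality.

One Taylor expansion yields both `exists_le_LOne` and `exists_isExceptionalConstant`. Let G be
ζ·L(χ) or ζ·L(χ₁)L(χ₂)L(χ₁χ₂), with residue r at 1. Since log G has nonnegative Dirichlet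
coefficients, the derivatives of G at 2 alternate in sign. Remove the pole, evaluate at 1-u with u
at most a small multiple of 1/log D, and truncate after O(log D) terms: G(1-u) ≤ 0 forces r ≫ u,
while G'(1-u) = 0 forces r ≪ u². Two exceptional zeros would give both, through Rolle's theorem. -/

namespace QuadraticLOne

open Complex Filter Topology

/-! ### Summation by parts for L(s,χ) in the half-plane Re s > 0. -/

variable {D : ℕ}

/-- The partial sums `χ(1) + ⋯ + χ(m)`. -/
noncomputable def charSum (χ : DirichletCharacter ℂ D) (m : ℕ) : ℂ :=
  ∑ k ∈ Finset.range m, χ ((k + 1 : ℕ) : ZMod D)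

lemma norm_charSum_le_self (χ : DirichletCharacter ℂ D) (m : ℕ) : ‖charSum χ m‖ ≤ m := by
  refine (norm_sum_le _ _).trans ?_
  calc _ ≤ ∑ k ∈ Finset.range m, (1 : ℝ) := Finset.sum_le_sum fun k _ => χ.norm_le_one _
    _ = m := by simp

lemma sum_range_char_mul (χ : DirichletCharacter ℂ D) (a : ℕ → ℂ) (N : ℕ) :
    ∑ n ∈ Finset.range N, χ ((n + 1 : ℕ) : ZMod D) * a n =
      charSum χ N * a N + ∑ n ∈ Finset.range N, charSum χ (n + 1) * (a n - a (n + 1)) := by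
  induction N with
  | zero => simp [charSum]
  | succ N ih =>
    rw [Finset.sum_range_succ, ih, Finset.sum_range_succ]
    have : charSum χ (N + 1) = charSum χ N + χ ((N + 1 : ℕ) : ZMod D) := by
      simp [charSum, Finset.sum_range_succ]
    rw [this]; ring

/-- The summands of `L(s, χ)` after summation by parts. -/
noncomputable def abelTerm (χ : DirichletCharacter ℂ D) (n : ℕ) (s : ℂ) : ℂ :=
  charSum χ (n + 1) * (((n + 1 : ℕ) : ℂ) ^ (-s) - ((n + 2 : ℕ) : ℂ) ^ (-s))

/-- The mean value inequality gains one power of n, so the rearranged series converges for Re s > 0.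
-/
lemma norm_cpow_sub_cpow_le {s : ℂ} (hs : 0 < s.re) (n : ℕ) :
    ‖((n + 1 : ℕ) : ℂ) ^ (-s) - ((n + 2 : ℕ) : ℂ) ^ (-s)‖ ≤
      ‖s‖ * ((n + 1 : ℕ) : ℝ) ^ (-s.re - 1) := by
  have hder : ∀ t ∈ Set.Icc ((n + 1 : ℕ) : ℝ) ((n + 2 : ℕ) : ℝ),
      HasDerivWithinAt (fun t : ℝ => (t : ℂ) ^ (-s)) (-s * (t : ℂ) ^ (-s - 1))
        (Set.Icc ((n + 1 : ℕ) : ℝ) ((n + 2 : ℕ) : ℝ)) t := by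
    intro t ht
    have ht0 : (0 : ℝ) < t := lt_of_lt_of_le (by positivity) ht.1
    refine HasDerivAt.hasDerivWithinAt ?_
    have := (hasDerivAt_id (t : ℂ)).cpow_const (c := -s) (Or.inl (by simpa using ht0))
    simpa using this.comp_ofReal
  have hb : ∀ t ∈ Set.Ico ((n + 1 : ℕ) : ℝ) ((n + 2 : ℕ) : ℝ),
      ‖-s * (t : ℂ) ^ (-s - 1)‖ ≤ ‖s‖ * ((n + 1 : ℕ) : ℝ) ^ (-s.re - 1) := by
    intro t ht
    have hn : (0 : ℝ) < ((n + 1 : ℕ) : ℝ) := by positivity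
    have ht0 : (0 : ℝ) < t := lt_of_lt_of_le hn ht.1
    rw [norm_mul, norm_neg, Complex.norm_cpow_eq_rpow_re_of_pos ht0]
    gcongr ?_ * ?_
    simp only [sub_re, neg_re, one_re]
    exact Real.rpow_le_rpow_of_nonpos hn ht.1 (by linarith)
  have := norm_image_sub_le_of_norm_deriv_le_segment' hder hb ((n + 2 : ℕ) : ℝ)
    (by constructor <;> push_cast <;> linarith)
  rw [norm_sub_rev]
  have h3 : ((n + 2 : ℕ) : ℝ) - ((n + 1 : ℕ) : ℝ) = 1 := by push_cast; ring
  rw [h3, mul_one] at this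
  simpa only [Complex.ofReal_natCast] using this

lemma summable_succ_rpow {a : ℝ} (ha : a < -1) :
    Summable fun n : ℕ => ((n + 1 : ℕ) : ℝ) ^ a :=
  (summable_nat_add_iff (f := fun n : ℕ => (n : ℝ) ^ a) 1).mpr
    (Real.summable_nat_rpow.mpr ha)

variable [NeZero D]

lemma sum_range_natCast_zmod {M : Type*} [AddCommMonoid M] (f : ZMod D → M) :
    ∑ k ∈ Finset.range D, f (k : ZMod D) = ∑ x : ZMod D, f x := by
  refine Finset.sum_bij' (fun k _ => (k : ZMod D)) (fun x _ => x.val) ?_ ?_ ?_ ?_ ?_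
  · simp
  · intro x _; simpa using ZMod.val_lt x
  · intro k hk; exact ZMod.val_cast_of_lt (Finset.mem_range.mp hk)
  · simp
  · simp

lemma charSum_add_modulus {χ : DirichletCharacter ℂ D} (hχ : χ ≠ 1) (m : ℕ) :
    charSum χ (m + D) = charSum χ m := by
  have h : ∑ k ∈ Finset.range D, χ ((m + k + 1 : ℕ) : ZMod D) = 0 := by
    have h1 := sum_range_natCast_zmod (D := D) (fun x => χ (x + ((m + 1 : ℕ) : ZMod D)))
    have h2 : ∑ x : ZMod D, χ (x + ((m + 1 : ℕ) : ZMod D)) = ∑ x : ZMod D, χ x :=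
      Fintype.sum_equiv (Equiv.addRight _) _ _ (fun x => rfl)
    rw [h2, MulChar.sum_eq_zero_of_ne_one hχ] at h1
    rw [← h1]
    refine Finset.sum_congr rfl fun k _ => ?_
    congr 1; push_cast; ring
  unfold charSum
  rw [Finset.sum_range_add, h, add_zero]

lemma norm_charSum_le_modulus {χ : DirichletCharacter ℂ D} (hχ : χ ≠ 1) (m : ℕ) :
    ‖charSum χ m‖ ≤ D := by
  induction m using Nat.strong_induction_on with
  | _ m ih =>
    rcases lt_or_ge m D with h | h
    · exact (norm_charSum_le_self χ m).trans (by exact_mod_cast h.le)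
    · obtain ⟨k, rfl⟩ := Nat.exists_eq_add_of_le' h
      rw [charSum_add_modulus hχ]
      exact ih k (by have := NeZero.pos D; omega)

/-- Interpolation between the trivial bound m and the bound D from periodicity. The choice of θ
trades a power of D against convergence to the left of 1. -/
lemma norm_charSum_le_rpow {χ : DirichletCharacter ℂ D} (hχ : χ ≠ 1) {θ : ℝ} (h0 : 0 ≤ θ)
    (h1 : θ ≤ 1) (m : ℕ) : ‖charSum χ m‖ ≤ (m : ℝ) ^ θ * (D : ℝ) ^ (1 - θ) := by
  have hx := norm_nonneg (charSum χ m)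
  calc ‖charSum χ m‖ = ‖charSum χ m‖ ^ θ * ‖charSum χ m‖ ^ (1 - θ) := by
        rw [← Real.rpow_add_of_nonneg hx h0 (by linarith)]; simp
    _ ≤ _ := by
        gcongr
        · exact norm_charSum_le_self χ m
        · exact norm_charSum_le_modulus hχ m

lemma norm_abelTerm_le {χ : DirichletCharacter ℂ D} (hχ : χ ≠ 1) {s : ℂ} (hs : 0 < s.re)
    {θ : ℝ} (h0 : 0 ≤ θ) (h1 : θ ≤ 1) (n : ℕ) :
    ‖abelTerm χ n s‖ ≤ ‖s‖ * (D : ℝ) ^ (1 - θ) * ((n + 1 : ℕ) : ℝ) ^ (θ - s.re - 1) := by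
  rw [abelTerm, norm_mul]
  have hn : (0 : ℝ) < ((n + 1 : ℕ) : ℝ) := by positivity
  calc _ ≤ (((n + 1 : ℕ) : ℝ) ^ θ * (D : ℝ) ^ (1 - θ)) *
        (‖s‖ * ((n + 1 : ℕ) : ℝ) ^ (-s.re - 1)) := by
        gcongr
        · exact norm_charSum_le_rpow hχ h0 h1 _
        · exact norm_cpow_sub_cpow_le hs n
    _ = ‖s‖ * (D : ℝ) ^ (1 - θ) *
        (((n + 1 : ℕ) : ℝ) ^ θ * ((n + 1 : ℕ) : ℝ) ^ (-s.re - 1)) := by ring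
    _ = _ := by rw [← Real.rpow_add hn]; ring_nf

lemma summable_abelTerm {χ : DirichletCharacter ℂ D} (hχ : χ ≠ 1) {s : ℂ} (hs : 0 < s.re) :
    Summable fun n => abelTerm χ n s := by
  refine Summable.of_norm_bounded ?_ (norm_abelTerm_le hχ hs le_rfl zero_le_one)
  exact (summable_succ_rpow (by linarith)).mul_left _

lemma LFunction_eq_tsum_abelTerm_of_one_lt {χ : DirichletCharacter ℂ D} (hχ : χ ≠ 1) {s : ℂ}
    (hs : 1 < s.re) : χ.LFunction s = ∑' n, abelTerm χ n s := by
  rw [χ.LFunction_eq_LSeries hs]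
  have h1 : HasSum (fun n => LSeries.term (fun n => χ n) s n) (LSeries (fun n => χ n) s) :=
    (χ.LSeriesSummable_of_one_lt_re hs).hasSum
  have h2 := ((hasSum_nat_add_iff' 1).mpr h1).tendsto_sum_nat
  have h3 := (summable_abelTerm hχ (zero_lt_one.trans hs)).hasSum.tendsto_sum_nat
  have h4 : Tendsto (fun N : ℕ => charSum χ N * ((N + 1 : ℕ) : ℂ) ^ (-s)) atTop (𝓝 0) := by
    refine squeeze_zero_norm (a := fun N : ℕ => (D : ℝ) * ((N + 1 : ℕ) : ℝ) ^ (-s.re)) ?_ ?_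
    · intro N
      rw [norm_mul]
      gcongr
      · exact norm_charSum_le_modulus hχ N
      · rw [Complex.norm_natCast_cpow_of_pos (by omega)]; simp
    · have := ((tendsto_rpow_neg_atTop (zero_lt_one.trans hs)).comp
        (tendsto_natCast_atTop_atTop.comp (tendsto_add_atTop_nat 1))).const_mul (D : ℝ)
      simpa [Function.comp_def] using this
  have h5 := h4.add h3
  rw [zero_add] at h5
  refine tendsto_nhds_unique ?_ h5
  have h6 : LSeries (fun n => χ n) s - ∑ i ∈ Finset.range 1, LSeries.term (fun n => χ n) s i =
      LSeries (fun n => χ n) s := by simp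
  rw [h6] at h2
  refine h2.congr fun N => ?_
  have := sum_range_char_mul χ (fun n => ((n + 1 : ℕ) : ℂ) ^ (-s)) N
  simp only [abelTerm]
  rw [← this]
  refine Finset.sum_congr rfl fun n _ => ?_
  rw [LSeries.term_of_ne_zero (by omega), Complex.cpow_neg, div_eq_mul_inv]

lemma differentiableAt_tsum_abelTerm {χ : DirichletCharacter ℂ D} (hχ : χ ≠ 1) {s : ℂ}
    (hs : 0 < s.re) : DifferentiableAt ℂ (fun z => ∑' n, abelTerm χ n z) s := by
  -- On this neighbourhood Re z is bounded below and ‖z‖ above, so one summable majorant serves for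
  -- all z.
  set V : Set ℂ := {z | s.re / 2 < z.re} ∩ Metric.ball 0 (‖s‖ + 1)
  have hV : IsOpen V := (isOpen_lt continuous_const continuous_re).inter Metric.isOpen_ball
  have hsV : s ∈ V := ⟨by simp only [Set.mem_ofPred_eq]; linarith, by simp⟩
  refine DifferentiableOn.differentiableAt (s := V) ?_ (hV.mem_nhds hsV)
  refine differentiableOn_tsum_of_summable_norm
    (u := fun n : ℕ => (‖s‖ + 1) * (D : ℝ) ^ (1 - 0 : ℝ) * ((n + 1 : ℕ) : ℝ) ^ (0 - s.re / 2 - 1))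
    ((summable_succ_rpow (by linarith)).mul_left _) ?_ hV ?_
  · intro n z hz
    unfold abelTerm
    refine DifferentiableAt.differentiableWithinAt ?_
    refine DifferentiableAt.const_mul (DifferentiableAt.sub ?_ ?_) _
    · exact differentiableAt_id.neg.const_cpow (Or.inl (by exact_mod_cast Nat.succ_ne_zero n))
    · exact differentiableAt_id.neg.const_cpow (Or.inl (by exact_mod_cast Nat.succ_ne_zero (n + 1)))
  · intro n z hz
    have hz1 : s.re / 2 < z.re := hz.1
    have hz2 : ‖z‖ < ‖s‖ + 1 := by simpa using hz.2
    refine (norm_abelTerm_le hχ (by linarith) le_rfl zero_le_one n).trans ?_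
    gcongr
    simp

/-- Summation by parts represents `L(s, χ)` on the half-plane `Re s > 0`. -/
lemma LFunction_eq_tsum_abelTerm {χ : DirichletCharacter ℂ D} (hχ : χ ≠ 1) {s : ℂ}
    (hs : 0 < s.re) : χ.LFunction s = ∑' n, abelTerm χ n s := by
  have hU : IsOpen {z : ℂ | 0 < z.re} := isOpen_lt continuous_const continuous_re
  have hf : AnalyticOnNhd ℂ χ.LFunction {z : ℂ | 0 < z.re} :=
    (DirichletCharacter.differentiable_LFunction hχ).differentiableOn.analyticOnNhd hU
  have hg : AnalyticOnNhd ℂ (fun z => ∑' n, abelTerm χ n z) {z : ℂ | 0 < z.re} :=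
    DifferentiableOn.analyticOnNhd
      (fun z hz => (differentiableAt_tsum_abelTerm hχ hz).differentiableWithinAt) hU
  refine hf.eqOn_of_preconnected_of_eventuallyEq hg
    (convex_halfSpace_re_gt 0).isPreconnected (z₀ := 2) (by simp) ?_ hs
  filter_upwards [(isOpen_lt continuous_const continuous_re).mem_nhds
    (show (1 : ℝ) < (2 : ℂ).re by norm_num)] with z hz
  exact LFunction_eq_tsum_abelTerm_of_one_lt hχ hz

lemma norm_LFunction_le {χ : DirichletCharacter ℂ D} (hχ : χ ≠ 1) {s : ℂ}
    {θ : ℝ} (h0 : 0 ≤ θ) (h1 : θ ≤ 1) (hs : θ < s.re) :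
    ‖χ.LFunction s‖ ≤
      ‖s‖ * (D : ℝ) ^ (1 - θ) * ∑' n : ℕ, ((n + 1 : ℕ) : ℝ) ^ (θ - s.re - 1) := by
  have hs0 : 0 < s.re := h0.trans_lt hs
  rw [LFunction_eq_tsum_abelTerm hχ hs0, ← tsum_mul_left]
  exact tsum_of_norm_bounded ((summable_succ_rpow (by linarith)).mul_left _).hasSum
    (norm_abelTerm_le hχ hs0 h0 h1)

end QuadraticLOne

/-! ### Uniform bounds for ζ and L(s,χ) near 1. -/

namespace QuadraticLOne

open Complex Filter Topology

lemma exists_norm_riemannZeta₀_le :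
    ∃ B : ℝ, 1 ≤ B ∧ ∀ s ∈ Metric.closedBall (2 : ℂ) (3 / 2), ‖riemannZeta₀ s‖ ≤ B := by
  obtain ⟨B, hB⟩ := (isCompact_closedBall (2 : ℂ) (3 / 2)).exists_bound_of_continuousOn
    differentiable_riemannZeta₀.continuous.continuousOn
  exact ⟨max 1 B, le_max_left _ _, fun s hs => (hB s hs).trans (le_max_right _ _)⟩

lemma tsum_succ_rpow_eq {x : ℝ} (hx : 1 < x) :
    ((∑' n : ℕ, ((n + 1 : ℕ) : ℝ) ^ (-x) : ℝ) : ℂ) = riemannZeta x := by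
  rw [zeta_eq_tsum_one_div_nat_add_one_cpow (by simpa using hx), ofReal_tsum]
  refine tsum_congr fun n => ?_
  rw [ofReal_cpow (by positivity), one_div, ofReal_neg, cpow_neg]
  simp

lemma exists_tsum_succ_rpow_le :
    ∃ C : ℝ, 1 ≤ C ∧ ∀ x : ℝ, 1 < x → x ≤ 2 →
      ∑' n : ℕ, ((n + 1 : ℕ) : ℝ) ^ (-x) ≤ C / (x - 1) := by
  obtain ⟨B, hB1, hB⟩ := exists_norm_riemannZeta₀_le
  refine ⟨1 + B, by linarith, fun x hx hx2 => ?_⟩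
  have h0 : 0 < x - 1 := by linarith
  have h1 : ‖((∑' n : ℕ, ((n + 1 : ℕ) : ℝ) ^ (-x) : ℝ) : ℂ)‖ ≤ (1 + B) / (x - 1) := by
    rw [tsum_succ_rpow_eq hx, riemannZeta_eq_inv_sub_add (by exact_mod_cast hx.ne')]
    have h2 : ‖((x : ℂ) - 1)⁻¹‖ = 1 / (x - 1) := by
      rw [norm_inv, ← ofReal_one, ← ofReal_sub, Complex.norm_real, Real.norm_of_nonneg h0.le,
        one_div]
    have h3 : ‖riemannZeta₀ x‖ ≤ B := by
      refine hB _ ?_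
      rw [Metric.mem_closedBall, dist_eq_norm, ← ofReal_ofNat, ← ofReal_sub, Complex.norm_real,
        Real.norm_eq_abs, abs_le]
      constructor <;> linarith
    calc _ ≤ 1 / (x - 1) + B := (norm_add_le _ _).trans (by rw [h2]; linarith)
      _ ≤ 1 / (x - 1) + B / (x - 1) := by
        gcongr
        rw [le_div_iff₀ h0]; nlinarith
      _ = _ := by ring
  rw [Complex.norm_real] at h1
  exact (le_abs_self _).trans h1

/-- Uses θ = 0. Losing a full factor D is harmless, as it only makes the later Taylor truncation of
length O(log D). -/
lemma exists_norm_LFunction_le_modulus :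
    ∃ C : ℝ, 1 ≤ C ∧ ∀ (D : ℕ) [NeZero D] (χ : DirichletCharacter ℂ D), χ ≠ 1 →
      ∀ s ∈ Metric.closedBall (2 : ℂ) (3 / 2), ‖χ.LFunction s‖ ≤ C * D := by
  have hS : Summable fun n : ℕ => ((n + 1 : ℕ) : ℝ) ^ (-(3 / 2) : ℝ) :=
    summable_succ_rpow (by norm_num)
  set T := ∑' n : ℕ, ((n + 1 : ℕ) : ℝ) ^ (-(3 / 2) : ℝ)
  have hT : 0 ≤ T := tsum_nonneg fun n => by positivity
  refine ⟨7 / 2 * T + 1, by linarith, fun D _ χ hχ s hs => ?_⟩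
  have hre : 1 / 2 ≤ s.re := by
    have := (abs_re_le_norm (s - 2)).trans (by simpa [dist_eq_norm] using hs)
    rw [abs_le] at this
    simp at this; linarith
  have hn : ‖s‖ ≤ 7 / 2 := by
    have h1 : ‖s - 2‖ ≤ 3 / 2 := by simpa [dist_eq_norm] using hs
    have h2 := norm_add_le (s - 2) 2
    rw [sub_add_cancel] at h2
    norm_num at h2; linarith
  have h := norm_LFunction_le hχ (θ := 0) le_rfl zero_le_one (s := s) (by linarith)
  have h3 : ∑' n : ℕ, ((n + 1 : ℕ) : ℝ) ^ (0 - s.re - 1) ≤ T := by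
    refine Summable.tsum_le_tsum (fun n => ?_) (summable_succ_rpow (by linarith)) hS
    exact Real.rpow_le_rpow_of_exponent_le (by simp) (by linarith)
  rw [sub_zero, Real.rpow_one] at h
  calc _ ≤ _ := h
    _ ≤ 7 / 2 * D * T := by gcongr
    _ ≤ (7 / 2 * T + 1) * D := by
      have : (0 : ℝ) ≤ D := by positivity
      nlinarith

lemma one_lt_log_of_three_le {D : ℕ} (hD : 3 ≤ D) : 1 < Real.log D := by
  rw [Real.lt_log_iff_exp_lt (by positivity)]
  have h1 := Real.exp_one_lt_d9
  have h2 : (3 : ℝ) ≤ D := by exact_mod_cast hD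
  linarith

/-- With θ = 1 - 1/log D the factor D^(1-θ) equals e, and the remaining sum is O(log D). -/
lemma exists_norm_LFunction_le_log :
    ∃ C : ℝ, 1 ≤ C ∧ ∀ (D : ℕ) [NeZero D] (χ : DirichletCharacter ℂ D), 3 ≤ D → χ ≠ 1 →
      ∀ s : ℂ, ‖s - 1‖ ≤ 1 / (2 * Real.log D) → ‖χ.LFunction s‖ ≤ C * Real.log D := by
  obtain ⟨C, hC1, hC⟩ := exists_tsum_succ_rpow_le
  refine ⟨3 * Real.exp 1 * C, ?_, fun D _ χ hD hχ s hs => ?_⟩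
  · have := Real.add_one_le_exp 1
    nlinarith
  have hl := one_lt_log_of_three_le hD
  set l := Real.log D
  set η := 1 / (2 * l) with hη
  have hη0 : 0 < η := by positivity
  have hη1 : η ≤ 1 / 2 := by
    rw [hη, div_le_div_iff₀ (by positivity) (by norm_num)]; linarith
  have hre : 1 - η ≤ s.re := by
    have := (abs_re_le_norm (s - 1)).trans hs
    rw [abs_le] at this
    simp only [sub_re, one_re] at this; linarith
  have hn : ‖s‖ ≤ 3 / 2 := by
    have h2 := norm_add_le (s - 1) 1
    rw [sub_add_cancel, norm_one] at h2
    linarith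
  have h := norm_LFunction_le hχ (θ := 1 - 2 * η) (by linarith) (by linarith) (s := s)
    (by linarith)
  have h3 : ∑' n : ℕ, ((n + 1 : ℕ) : ℝ) ^ (1 - 2 * η - s.re - 1) ≤ C / η := by
    refine le_trans (Summable.tsum_le_tsum (g := fun n : ℕ => ((n + 1 : ℕ) : ℝ) ^ (-(1 + η)))
      (fun n => ?_) (summable_succ_rpow (by linarith)) (summable_succ_rpow (by linarith)))
      ((hC (1 + η) (by linarith) (by linarith)).trans_eq (by simp))
    exact Real.rpow_le_rpow_of_exponent_le (by simp) (by linarith)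
  have h4 : (D : ℝ) ^ (1 - (1 - 2 * η)) = Real.exp 1 := by
    have hD0 : (0 : ℝ) < D := by exact_mod_cast (by omega : 0 < D)
    rw [Real.rpow_def_of_pos hD0]
    congr 1
    change l * _ = 1
    rw [hη]; field_simp; ring
  rw [h4] at h
  calc _ ≤ _ := h
    _ ≤ 3 / 2 * Real.exp 1 * (C / η) := by gcongr
    _ = _ := by rw [hη]; field_simp

/-- Cauchy's estimate on circles of radius 1/(4 log D) bounds the derivative by O((log D)²). -/
lemma exists_norm_LFunction_sub_le :
    ∃ C : ℝ, 1 ≤ C ∧ ∀ (D : ℕ) [NeZero D] (χ : DirichletCharacter ℂ D), 3 ≤ D → χ ≠ 1 →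
      ∀ x : ℝ, 1 ≤ x → x ≤ 1 + 1 / (4 * Real.log D) →
        ‖χ.LFunction x - χ.LFunction 1‖ ≤ C * Real.log D ^ 2 * (x - 1) := by
  obtain ⟨C, hC1, hC⟩ := exists_norm_LFunction_le_log
  refine ⟨4 * C, by linarith, fun D _ χ hD hχ x hx1 hx2 => ?_⟩
  have hl := one_lt_log_of_three_le hD
  have hd := DirichletCharacter.differentiable_LFunction hχ
  set l := Real.log D
  have hr : 0 < 1 / (4 * l) := by positivity
  have hder : ∀ z ∈ Metric.closedBall (1 : ℂ) (1 / (4 * l)),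
      ‖deriv χ.LFunction z‖ ≤ 4 * C * l ^ 2 := by
    intro z hz
    have := Complex.norm_deriv_le_of_forall_mem_sphere_norm_le (c := z) (R := 1 / (4 * l))
      (C := C * l) (f := χ.LFunction) hr hd.diffContOnCl ?_
    · refine this.trans_eq ?_
      field_simp
    · intro w hw
      refine hC D χ hD hχ w ?_
      have h1 : ‖w - z‖ = 1 / (4 * l) := by simpa [dist_eq_norm] using hw
      have h2 : ‖z - 1‖ ≤ 1 / (4 * l) := by simpa [dist_eq_norm] using hz
      have h3 := norm_add_le (w - z) (z - 1)
      rw [sub_add_sub_cancel] at h3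
      refine h3.trans ((add_le_add h1.le h2).trans_eq ?_)
      change 1 / (4 * l) + 1 / (4 * l) = 1 / (2 * l)
      field_simp; norm_num
  have := (convex_closedBall (1 : ℂ) (1 / (4 * l))).norm_image_sub_le_of_norm_deriv_le
    (f := χ.LFunction) (fun z _ => hd z) hder (x := 1) (y := x)
    (Metric.mem_closedBall_self hr.le) ?_
  · refine this.trans_eq ?_
    rw [← ofReal_one, ← ofReal_sub, Complex.norm_real, Real.norm_of_nonneg (by linarith)]
  · rw [Metric.mem_closedBall, dist_eq_norm, ← ofReal_one, ← ofReal_sub, Complex.norm_real,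
      Real.norm_of_nonneg (by linarith)]
    linarith

/-! ### Real characters and the series for log L(x,χ). -/

section Quadratic

variable {D : ℕ}

lemma apply_eq_zero_or_one_or_neg_one {χ : DirichletCharacter ℂ D} (hχ : χ ^ 2 = 1)
    (a : ZMod D) : χ a = 0 ∨ χ a = 1 ∨ χ a = -1 := by
  by_cases ha : IsUnit a
  · right
    have h : χ a ^ 2 = 1 := by
      rw [← MulChar.pow_apply' χ two_ne_zero, hχ, MulChar.one_apply ha]
    exact sq_eq_one_iff.mp h
  · exact Or.inl (χ.map_nonunit ha)

lemma ofReal_re_apply {χ : DirichletCharacter ℂ D} (hχ : χ ^ 2 = 1) (a : ZMod D) :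
    (((χ a).re : ℝ) : ℂ) = χ a := by
  rcases apply_eq_zero_or_one_or_neg_one hχ a with h | h | h <;> simp [h]

lemma abs_re_apply_le_one (χ : DirichletCharacter ℂ D) (a : ZMod D) : |(χ a).re| ≤ 1 :=
  (abs_re_le_norm _).trans (χ.norm_le_one a)

lemma charSum_im {χ : DirichletCharacter ℂ D} (hχ : χ ^ 2 = 1) (m : ℕ) :
    (charSum χ m).im = 0 := by
  rw [charSum, im_sum]
  refine Finset.sum_eq_zero fun k _ => ?_
  rw [← ofReal_re_apply hχ, ofReal_im]

/-- The nonnegative weights `Λ(n) / log n · n⁻ˣ` of the Dirichlet series of `log ζ(x)`. -/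
noncomputable def logWeight (x : ℝ) (n : ℕ) : ℝ :=
  ArithmeticFunction.vonMangoldt n / Real.log n * (n : ℝ) ^ (-x)

lemma logWeight_nonneg (x : ℝ) (n : ℕ) : 0 ≤ logWeight x n :=
  mul_nonneg (div_nonneg ArithmeticFunction.vonMangoldt_nonneg (Real.log_natCast_nonneg n))
    (by positivity)

lemma vonMangoldt_div_log_le_one (n : ℕ) :
    ArithmeticFunction.vonMangoldt n / Real.log n ≤ 1 :=
  div_le_one_of_le₀ ArithmeticFunction.vonMangoldt_le_log (Real.log_natCast_nonneg n)

lemma summable_logWeight {x : ℝ} (hx : 1 < x) : Summable (logWeight x) := by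
  refine Summable.of_nonneg_of_le (logWeight_nonneg x) (fun n => ?_)
    (Real.summable_nat_rpow.mpr (by linarith : -x < -1))
  exact mul_le_of_le_one_left (by positivity) (vonMangoldt_div_log_le_one n)

/-- The Dirichlet series of `log L(x, χ)` for a real character `χ`. -/
noncomputable def logL (χ : DirichletCharacter ℂ D) (x : ℝ) : ℝ :=
  ∑' n : ℕ, (χ (n : ZMod D)).re * logWeight x n

lemma summable_re_mul_logWeight (χ : DirichletCharacter ℂ D) {x : ℝ} (hx : 1 < x) :
    Summable fun n : ℕ => (χ (n : ZMod D)).re * logWeight x n := by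
  refine Summable.of_norm_bounded (summable_logWeight hx) fun n => ?_
  rw [norm_mul, Real.norm_of_nonneg (logWeight_nonneg x n)]
  exact mul_le_of_le_one_left (logWeight_nonneg x n) (abs_re_apply_le_one χ _)

lemma LSeries_log_eq_logL {χ : DirichletCharacter ℂ D} (hχ : χ ^ 2 = 1) (x : ℝ) :
    LSeries (fun n => χ n * ArithmeticFunction.vonMangoldt n / Real.log n) x = (logL χ x : ℂ) := by
  rw [LSeries_def₀ (by simp), logL, ofReal_tsum]
  refine tsum_congr fun n => ?_
  rw [logWeight, ofReal_mul, ofReal_re_apply hχ, ofReal_mul, ofReal_cpow (by positivity),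
    ofReal_neg, cpow_neg, ofReal_div, ofReal_natCast]
  ring

lemma abs_logL_le (χ : DirichletCharacter ℂ D) {x : ℝ} (hx : 1 < x) :
    |logL χ x| ≤ ∑' n, logWeight x n := by
  rw [← Real.norm_eq_abs]
  refine tsum_of_norm_bounded (summable_logWeight hx).hasSum fun n => ?_
  rw [norm_mul, Real.norm_of_nonneg (logWeight_nonneg x n)]
  exact mul_le_of_le_one_left (logWeight_nonneg x n) (abs_re_apply_le_one χ _)

lemma exp_tsum_logWeight {x : ℝ} (hx : 1 < x) :
    Real.exp (∑' n, logWeight x n) = ∑' n : ℕ, ((n + 1 : ℕ) : ℝ) ^ (-x) := by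
  have h1 := riemannZeta_eq_exp_LSeries (s := x) (by simpa using hx)
  rw [← tsum_succ_rpow_eq hx, LSeries_def₀ (by simp)] at h1
  have h2 : ∑' n : ℕ, ((ArithmeticFunction.vonMangoldt n : ℂ) / (Real.log n : ℂ)) / (n : ℂ) ^ (x : ℂ)
      = ((∑' n, logWeight x n : ℝ) : ℂ) := by
    rw [ofReal_tsum]
    refine tsum_congr fun n => ?_
    rw [logWeight, ofReal_mul, ofReal_cpow (by positivity),
      ofReal_neg, cpow_neg, ofReal_div, ofReal_natCast]
    ring
  rw [h2, ← ofReal_exp] at h1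
  exact_mod_cast h1

variable [NeZero D]

lemma LFunction_im {χ : DirichletCharacter ℂ D} (hχ : IsQuadraticChar χ) {x : ℝ} (hx : 0 < x) :
    (χ.LFunction x).im = 0 := by
  have hx' : 0 < (x : ℂ).re := by simpa using hx
  rw [LFunction_eq_tsum_abelTerm hχ.1 hx', im_tsum (summable_abelTerm hχ.1 hx')]
  refine (tsum_congr fun n => ?_).trans tsum_zero
  have h : ∀ m : ℕ, ((m : ℂ) ^ (-(x : ℂ))) = (((m : ℝ) ^ (-x) : ℝ) : ℂ) := fun m => by
    rw [ofReal_cpow (by positivity)]; simp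
  rw [abelTerm, h, h, ← ofReal_sub, mul_im, charSum_im hχ.2]
  simp

lemma ofReal_re_LFunction {χ : DirichletCharacter ℂ D} (hχ : IsQuadraticChar χ) {x : ℝ}
    (hx : 0 < x) : (((χ.LFunction x).re : ℝ) : ℂ) = χ.LFunction x := by
  apply Complex.ext <;> simp [LFunction_im hχ hx]

lemma LFunction_eq_exp_logL {χ : DirichletCharacter ℂ D} (hχ : χ ^ 2 = 1) {x : ℝ} (hx : 1 < x) :
    χ.LFunction x = (Real.exp (logL χ x) : ℂ) := by
  have hx' : 1 < (x : ℂ).re := by simpa using hx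
  rw [χ.LFunction_eq_LSeries hx', ← χ.LSeries_eq_exp_LSeries hx', LSeries_log_eq_logL hχ,
    ofReal_exp]

/-- To the right of 1 the value is an exponential; continuity gives nonnegativity at 1, and
nonvanishing there makes it strict. -/
lemma LFunction_one_re_pos {χ : DirichletCharacter ℂ D} (hχ : IsQuadraticChar χ) :
    0 < (χ.LFunction 1).re := by
  have hc : Continuous fun x : ℝ => (χ.LFunction x).re :=
    continuous_re.comp ((DirichletCharacter.differentiable_LFunction hχ.1).continuous.comp
      continuous_ofReal)
  have h0 : 0 ≤ (χ.LFunction (1 : ℝ)).re := by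
    refine ge_of_tendsto (x := 𝓝[>] (1 : ℝ))
      ((hc.tendsto (1 : ℝ)).mono_left nhdsWithin_le_nhds) ?_
    filter_upwards [self_mem_nhdsWithin] with x hx
    rw [LFunction_eq_exp_logL hχ.2 hx, ofReal_re]
    exact (Real.exp_pos _).le
  rw [ofReal_one] at h0
  refine h0.lt_of_ne' fun h => ?_
  refine DirichletCharacter.LFunction_apply_one_ne_zero hχ.1 ?_
  have := ofReal_re_LFunction hχ zero_lt_one
  rw [ofReal_one, h, ofReal_zero] at this
  exact this.symm

end Quadratic

end QuadraticLOne

/-! ### Taylor expansion at 2 with the pole at 1 removed. -/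

namespace QuadraticLOne

open Complex Filter Topology
open scoped ComplexOrder

/-- Induction through (e^F)' = e^F F' and Leibniz: F has alternating derivatives, and the signs
(-1)^i and (-1)^(n-i+1) multiply to (-1)^(n+1). -/
lemma iteratedDeriv_exp_LSeries_alternating {c : ℕ → ℂ} (hc : 0 ≤ c)
    (habs : LSeries.abscissaOfAbsConv c ≤ 1) (n : ℕ) :
    0 ≤ (-1) ^ n * iteratedDeriv n (fun s => exp (LSeries c s)) 2 := by
  have hlt : ∀ s : ℂ, 1 < s.re → LSeries.abscissaOfAbsConv c < s.re := fun s hs =>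
    habs.trans_lt (by exact_mod_cast hs)
  have han : ∀ s : ℂ, 1 < s.re → AnalyticAt ℂ (LSeries c) s := fun s hs =>
    LSeries_analyticOnNhd c s (hlt s hs)
  have hU : IsOpen {s : ℂ | 1 < s.re} := isOpen_lt continuous_const continuous_re
  have h2 : (2 : ℂ) ∈ {s : ℂ | 1 < s.re} := by simp
  have hℓ : ∀ n, 0 ≤ (-1) ^ n * iteratedDeriv n (LSeries c) 2 := fun n => by
    have := LSeries.iteratedDeriv_alternating hc (x := 2) (by exact_mod_cast hlt 2 h2) n
    simpa using this
  have hE : ∀ s : ℂ, 1 < s.re → AnalyticAt ℂ (fun s => exp (LSeries c s)) s := fun s hs =>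
    (han s hs).cexp
  have hder : Set.EqOn (deriv fun s => exp (LSeries c s))
      (fun s => exp (LSeries c s) * deriv (LSeries c) s) {s : ℂ | 1 < s.re} := fun s hs =>
    deriv_cexp (han s hs).differentiableAt
  induction n using Nat.strong_induction_on with
  | _ n ih =>
    cases n with
    | zero =>
      have h := hℓ 0
      simp only [pow_zero, one_mul, iteratedDeriv_zero] at h ⊢
      obtain ⟨x, hx⟩ : ∃ x : ℝ, LSeries c 2 = x :=
        ⟨_, (Complex.eq_re_of_ofReal_le (r := 0) (by simpa using h))⟩
      rw [hx, ← ofReal_exp]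
      exact_mod_cast (Real.exp_pos x).le
    | succ n =>
      rw [iteratedDeriv_succ', hder.iteratedDeriv_of_isOpen hU n h2,
        iteratedDeriv_fun_mul (hE 2 h2).contDiffAt (han 2 h2).deriv.contDiffAt, Finset.mul_sum]
      refine Finset.sum_nonneg fun i hi => ?_
      have hi' : i ≤ n := Nat.lt_succ_iff.mp (Finset.mem_range.mp hi)
      have h1 := ih i (by omega)
      have h3 := hℓ (n - i + 1)
      rw [iteratedDeriv_succ'] at h3
      have h4 : ((-1 : ℂ)) ^ (n + 1) = (-1) ^ i * (-1) ^ (n - i + 1) := by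
        rw [← pow_add]; congr 1; omega
      have h5 : (0 : ℂ) ≤ (n.choose i : ℂ) := Nat.cast_nonneg _
      convert mul_nonneg h5 (mul_nonneg h1 h3) using 1
      rw [h4]; ring

lemma iteratedDeriv_inv_sub_one (k : ℕ) :
    iteratedDeriv k (fun s : ℂ => (s - 1)⁻¹) 2 = (-1) ^ k * k.factorial := by
  have := congrFun (iter_deriv_inv_linear_sub (𝕜 := ℂ) k 1 1) 2
  rw [iteratedDeriv_eq_iterate]
  simp only [one_mul] at this
  rw [this]; norm_num

/-- The circle stays at distance at least 1/2 from 1, so the numerator bound 2M becomes 4M. -/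
lemma dslope_bound {P : ℂ → ℂ} {M : ℝ} (hM : ∀ s ∈ Metric.closedBall (2 : ℂ) (3 / 2), ‖P s‖ ≤ M)
    {s : ℂ} (hs : s ∈ Metric.sphere (2 : ℂ) (3 / 2)) : ‖dslope P 1 s‖ ≤ 4 * M := by
  have h1 : ‖s - 2‖ = 3 / 2 := by simpa [dist_eq_norm] using hs
  have h2 : 1 / 2 ≤ ‖s - 1‖ := by
    have := norm_sub_norm_le (s - 2) (-1)
    rw [h1, norm_neg, norm_one] at this
    have h3 : s - 2 - -1 = s - 1 := by ring
    rw [h3] at this; linarith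
  have hne : s ≠ 1 := fun h => by rw [h, sub_self, norm_zero] at h2; norm_num at h2
  have hP1 : ‖P 1‖ ≤ M := hM 1 (by rw [Metric.mem_closedBall, dist_eq_norm]; norm_num)
  have hPs : ‖P s‖ ≤ M := hM s (Metric.sphere_subset_closedBall hs)
  rw [dslope_of_ne _ hne, slope_def_field, norm_div, div_le_iff₀ (by linarith)]
  have := norm_sub_le (P s) (P 1)
  have hM0 : 0 ≤ M := (norm_nonneg _).trans hP1
  nlinarith

/-- The Taylor expansion at `2` of `ζ(s) P(s) - P(1) / (s - 1)`, when `ζ P` is the exponential of a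
Dirichlet series with nonnegative coefficients. -/
lemma exists_taylor_coeff {B : ℝ}
    (hB : ∀ s ∈ Metric.closedBall (2 : ℂ) (3 / 2), ‖riemannZeta₀ s‖ ≤ B)
    {c : ℕ → ℂ} (hc : 0 ≤ c) (habs : LSeries.abscissaOfAbsConv c ≤ 1)
    {P : ℂ → ℂ} (hP : Differentiable ℂ P)
    (hG : ∀ s : ℂ, 1 < s.re → riemannZeta s * P s = exp (LSeries c s))
    {r : ℝ} (hr : P 1 = r) {M : ℝ}
    (hM : ∀ s ∈ Metric.closedBall (2 : ℂ) (3 / 2), ‖P s‖ ≤ M) :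
    ∃ e : ℕ → ℝ, (∀ k, 0 ≤ e k + r) ∧ 1 ≤ e 0 + r ∧
      (∀ k, |e k| ≤ (B + 4) * M * (2 / 3) ^ k) ∧
      ∀ u : ℝ, 0 < u →
        HasSum (fun k => e k * (1 + u) ^ k) ((riemannZeta (1 - u) * P (1 - u)).re + r / u) ∧
        HasSum (fun k : ℕ => (k + 1) * e (k + 1) * (1 + u) ^ k)
          (-(deriv (fun s => riemannZeta s * P s) (1 - u)).re - r / u ^ 2) := by
  -- This is ζP - r/(s-1), written so that it is visibly entire.
  set h : ℂ → ℂ := fun s => riemannZeta₀ s * P s + dslope P 1 s with hh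
  have hds : Differentiable ℂ (dslope P 1) := by
    rw [← differentiableOn_univ, Complex.differentiableOn_dslope Filter.univ_mem]
    exact hP.differentiableOn
  have hd : Differentiable ℂ h := (differentiable_riemannZeta₀.mul hP).add hds
  have heq : ∀ s : ℂ, s ≠ 1 → h s = riemannZeta s * P s - r * (s - 1)⁻¹ := by
    intro s hs
    simp only [hh]
    rw [dslope_of_ne _ hs, slope_def_field, hr, riemannZeta_eq_inv_sub_add hs]
    ring
  have hGd : ∀ s : ℂ, s ≠ 1 → DifferentiableAt ℂ (fun s => riemannZeta s * P s) s := fun s hs =>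
    (differentiableAt_riemannZeta hs).mul (hP s)
  have hU : IsOpen {s : ℂ | 1 < s.re} := isOpen_lt continuous_const continuous_re
  have h2 : (2 : ℂ) ∈ {s : ℂ | 1 < s.re} := by simp
  have hgt : ∀ s : ℂ, 1 < s.re → s ≠ 1 := fun s hs h => by rw [h] at hs; simp at hs
  -- the Taylor coefficients
  set E : ℕ → ℂ := fun k => (-1) ^ k * iteratedDeriv k h 2 / k.factorial with hE
  have hfac : ∀ k : ℕ, ((k.factorial : ℕ) : ℂ) ≠ 0 := fun k =>
    by exact_mod_cast k.factorial_ne_zero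
  have hsgn : ∀ k : ℕ, ((-1 : ℂ)) ^ k * (-1) ^ k = 1 := fun k => by
    rw [← mul_pow]; norm_num
  -- The normalised derivatives of r/(s-1) at 2 are all equal to r, so adding r recovers those of
  -- ζP.
  have hEG : ∀ k, E k + r =
      (-1) ^ k * iteratedDeriv k (fun s => exp (LSeries c s)) 2 / k.factorial := by
    intro k
    have h3 : Set.EqOn h (fun s => exp (LSeries c s) - r * (s - 1)⁻¹) {s : ℂ | 1 < s.re} :=
      fun s hs => by rw [heq s (hgt s hs), hG s hs]
    have h4 : ContDiffAt ℂ k (fun s => exp (LSeries c s)) 2 :=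
      (LSeries_analyticOnNhd c 2 (habs.trans_lt (by exact_mod_cast (one_lt_two : (1 : ℝ) < 2)))).cexp.contDiffAt
    have h5 : ContDiffAt ℂ k (fun s : ℂ => (s - 1)⁻¹) 2 :=
      (contDiffAt_id.sub contDiffAt_const).inv (by norm_num)
    simp only [hE]
    rw [h3.iteratedDeriv_of_isOpen hU k h2, iteratedDeriv_fun_sub h4 (contDiffAt_const.mul h5),
      iteratedDeriv_const_mul_field, iteratedDeriv_inv_sub_one, mul_sub,
      mul_left_comm, ← mul_assoc ((-1 : ℂ) ^ k) ((-1) ^ k), hsgn, one_mul, sub_div,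
      mul_div_cancel_right₀ _ (hfac k)]
    ring
  refine ⟨fun k => (E k).re, fun k => ?_, ?_, fun k => ?_, fun u hu => ⟨?_, ?_⟩⟩
  · have h3 : 0 ≤ E k + r := by
      rw [hEG]
      exact div_nonneg (iteratedDeriv_exp_LSeries_alternating hc habs k) (Nat.cast_nonneg _)
    simpa using (Complex.le_def.mp h3).1
  · have h3 : E 0 + r = exp (LSeries c 2) := by rw [hEG]; simp
    have h4 := LSeries.iteratedDeriv_alternating hc (x := 2)
      (habs.trans_lt (by exact_mod_cast (one_lt_two : (1 : ℝ) < 2))) 0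
    simp only [pow_zero, one_mul, iteratedDeriv_zero, ofReal_ofNat] at h4
    obtain ⟨x, hx⟩ : ∃ x : ℝ, LSeries c 2 = x :=
      ⟨_, (Complex.eq_re_of_ofReal_le (r := 0) (by simpa using h4))⟩
    rw [hx] at h3 h4
    have h5 := congrArg re h3
    rw [← ofReal_exp, ofReal_re, add_re, ofReal_re] at h5
    rw [h5]
    exact Real.one_le_exp (by exact_mod_cast h4)
  · refine (abs_re_le_norm _).trans ?_
    have h3 := Complex.norm_iteratedDeriv_le_of_forall_mem_sphere_norm_le (c := 2) (R := 3 / 2)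
      (C := (B + 4) * M) (f := h) k (by norm_num) hd.diffContOnCl ?_
    · simp only [hE]
      rw [norm_div, norm_mul, norm_pow, norm_neg, norm_one, one_pow, one_mul, Complex.norm_natCast,
        div_le_iff₀ (by exact_mod_cast k.factorial_pos)]
      refine h3.trans_eq ?_
      rw [div_pow, div_pow]; field_simp
    · intro s hs
      have h4 := hB s (Metric.sphere_subset_closedBall hs)
      have h5 := hM s (Metric.sphere_subset_closedBall hs)
      calc ‖h s‖ ≤ ‖riemannZeta₀ s‖ * ‖P s‖ + ‖dslope P 1 s‖ :=
            (norm_add_le _ _).trans (by rw [norm_mul])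
        _ ≤ B * M + 4 * M := by
          gcongr
          · exact (norm_nonneg _).trans h4
          · exact dslope_bound hM hs
        _ = _ := by ring
  · have h3 := (Complex.hasSum_taylorSeries_of_entire hd 2 (1 - u)).mapL reCLM
    have hne : (1 - (u : ℂ)) ≠ 1 := by
      intro h; have := congrArg re h; simp at this; exact hu.ne' this
    rw [heq _ hne] at h3
    convert h3 using 1
    · ext k
      simp only [reCLM_apply, hE]
      rw [show ((1 : ℂ) - u - 2) = -1 * ((1 + u : ℝ) : ℂ) by push_cast; ring, mul_pow,
        ← ofReal_pow, ← re_mul_ofReal]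
      congr 1
      simp only [smul_eq_mul]
      ring
    · simp only [reCLM_apply, sub_re]
      rw [show ((1 : ℂ) - u - 1)⁻¹ = ((-u⁻¹ : ℝ) : ℂ) by push_cast; rw [sub_sub_cancel_left, inv_neg],
        ← ofReal_mul, ofReal_re]
      ring
  · have h3 := (Complex.hasSum_taylorSeries_of_entire hd.deriv 2 (1 - u)).mapL reCLM
    have hne : (1 - (u : ℂ)) ≠ 1 := by
      intro h; have := congrArg re h; simp at this; exact hu.ne' this
    have hder : deriv h (1 - u) =
        deriv (fun s => riemannZeta s * P s) (1 - u) + r * ((1 - u : ℂ) - 1)⁻¹ ^ 2 := by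
      have h4 : h =ᶠ[𝓝 (1 - (u : ℂ))] fun s => riemannZeta s * P s - r * (s - 1)⁻¹ := by
        filter_upwards [isOpen_ne.mem_nhds hne] with s hs using heq s hs
      have h6 : ((1 - u : ℂ) - 1) ≠ 0 := sub_ne_zero.mpr hne
      have h5 : HasDerivAt (fun s : ℂ => r * (s - 1)⁻¹) (r * (-1 / ((1 - u : ℂ) - 1) ^ 2)) (1 - u) :=
        (((hasDerivAt_id (1 - u : ℂ)).sub_const 1).inv h6).const_mul _
      rw [h4.deriv_eq, ((hGd _ hne).hasDerivAt.fun_sub h5).deriv]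
      field_simp
      ring
    have hval : -reCLM (deriv h (1 - u)) =
        -(deriv (fun s => riemannZeta s * P s) (1 - u)).re - r / u ^ 2 := by
      rw [hder, show ((1 : ℂ) - u - 1)⁻¹ = ((-u⁻¹ : ℝ) : ℂ) by
          push_cast; rw [sub_sub_cancel_left, inv_neg],
        ← ofReal_pow, ← ofReal_mul, reCLM_apply, add_re, ofReal_re]
      field_simp
      ring
    have h4 := h3.neg
    rw [hval] at h4
    refine h4.congr_fun fun k => ?_
    simp only [reCLM_apply, hE]
    rw [show ((1 : ℂ) - u - 2) = -1 * ((1 + u : ℝ) : ℂ) by push_cast; ring, mul_pow,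
      ← ofReal_pow, ← neg_re, show ((k : ℝ) + 1) = ((k + 1 : ℕ) : ℝ) by push_cast; ring,
      ← re_ofReal_mul, ← re_mul_ofReal, ← iteratedDeriv_succ']
    congr 1
    simp only [smul_eq_mul]
    have h7 := hfac k
    have h8 : ((k : ℂ) + 1) ≠ 0 := by exact_mod_cast Nat.succ_ne_zero k
    rw [Nat.factorial_succ]
    push_cast
    field_simp
    ring

end QuadraticLOne

/-! ### Truncating the Taylor series after O(log D) terms. -/

namespace QuadraticLOne

open Complex Filter Topology
open scoped ComplexOrder

lemma sum_range_sub_le_of_hasSum {f : ℕ → ℝ} {v A q : ℝ} (hq0 : 0 ≤ q) (hq1 : q < 1)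
    (hf : ∀ k, |f k| ≤ A * q ^ k) (hv : HasSum f v) (K : ℕ) :
    ∑ k ∈ Finset.range K, f k - A * q ^ K / (1 - q) ≤ v := by
  have h1 := (hasSum_nat_add_iff' K).mpr hv
  have h2 : HasSum (fun k => -(A * q ^ K * q ^ k)) (-(A * q ^ K * (1 - q)⁻¹)) :=
    ((hasSum_geometric_of_lt_one hq0 hq1).mul_left _).neg
  have h3 := hasSum_le (fun k => ?_) h2 h1
  · rw [← div_eq_mul_inv] at h3; linarith
  · have := neg_le_of_abs_le (hf (k + K))
    rw [pow_add] at this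
    linarith

section TaylorBounds

variable {e : ℕ → ℝ} {r N u v : ℝ} {K : ℕ}

lemma one_add_pow_le_three (hu : 0 < u) (huK : u * K ≤ 1 / 3) {k : ℕ} (hk : k ≤ K) :
    (1 + u) ^ k ≤ 3 := by
  calc (1 + u) ^ k ≤ Real.exp u ^ k := by
        gcongr; linarith [Real.add_one_le_exp u]
    _ = Real.exp (k * u) := by rw [← Real.exp_nat_mul]
    _ ≤ Real.exp 1 := by
        apply Real.exp_le_exp.mpr
        have : (k : ℝ) ≤ K := by exact_mod_cast hk
        nlinarith
    _ ≤ 3 := Real.exp_one_lt_three.le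

/-- Each k < K contributes at least -r(1+u)^k ≥ -3r, with an extra 1 from k = 0. The tail has ratio
2/3 · 9/8 = 3/4 and is at most 1/2. -/
lemma half_sub_le_of_hasSum (hr : 0 ≤ r) (h1 : ∀ k, 0 ≤ e k + r) (h2 : 1 ≤ e 0 + r) (hN : 0 ≤ N)
    (h3 : ∀ k, |e k| ≤ N * (2 / 3) ^ k) (hK : 32 * N * (7 / 8) ^ K ≤ 1 / 2) (hK1 : 1 ≤ K)
    (hu : 0 < u) (hu8 : u ≤ 1 / 8) (huK : u * K ≤ 1 / 3)
    (hv : HasSum (fun k => e k * (1 + u) ^ k) v) : 1 / 2 - 3 * K * r ≤ v := by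
  have h4 := sum_range_sub_le_of_hasSum (A := N) (q := 3 / 4) (by norm_num) (by norm_num)
    (fun k => ?_) hv K
  · have h5 : N * (3 / 4) ^ K / (1 - 3 / 4) ≤ 1 / 2 := by
      have : ((3 : ℝ) / 4) ^ K ≤ (7 / 8) ^ K :=
        pow_le_pow_left₀ (by norm_num) (by norm_num) K
      have := mul_le_mul_of_nonneg_left this hN
      have h0 : 0 ≤ N * (7 / 8) ^ K := by positivity
      rw [div_le_iff₀ (by norm_num)]
      linarith
    have h6 : 1 - 3 * K * r ≤ ∑ k ∈ Finset.range K, e k * (1 + u) ^ k := by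
      have h7 : ∀ k ∈ Finset.range K,
          (if k = 0 then 1 else 0) - 3 * r ≤ e k * (1 + u) ^ k := by
        intro k hk
        have h8 := one_add_pow_le_three hu huK (Finset.mem_range.mp hk).le
        have h9 : 0 < (1 + u) ^ k := by positivity
        have h10 : (if k = 0 then (1 : ℝ) else 0) ≤ (e k + r) * (1 + u) ^ k := by
          split_ifs with h
          · subst h; simpa using h2
          · exact mul_nonneg (h1 k) h9.le
        nlinarith
      have h11 := Finset.sum_le_sum h7
      rw [Finset.sum_sub_distrib, Finset.sum_ite_eq' (Finset.range K) 0 (fun _ => (1 : ℝ)),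
        if_pos (Finset.mem_range.mpr hK1)] at h11
      simp only [Finset.sum_const, Finset.card_range, nsmul_eq_mul] at h11
      linarith
    linarith
  · rw [abs_mul, abs_of_pos (show 0 < (1 + u) ^ k by positivity)]
    calc _ ≤ N * (2 / 3) ^ k * (9 / 8) ^ k := by
          gcongr
          · exact h3 k
          · linarith
      _ = N * (3 / 4) ^ k := by rw [mul_assoc, ← mul_pow]; norm_num

/-- The factor k+1 ≤ 6(7/6)^k changes the ratio to 7/6 · 2/3 · 9/8 = 7/8. The tail 4N(7/8)^K/(1-7/8)
explains the constant 32. -/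
lemma neg_le_of_hasSum_deriv (hr : 0 ≤ r) (h1 : ∀ k, 0 ≤ e k + r) (hN : 0 ≤ N)
    (h3 : ∀ k, |e k| ≤ N * (2 / 3) ^ k) (hK : 32 * N * (7 / 8) ^ K ≤ 1 / 2)
    (hu : 0 < u) (hu8 : u ≤ 1 / 8) (huK : u * K ≤ 1 / 3)
    (hv : HasSum (fun k : ℕ => (k + 1) * e (k + 1) * (1 + u) ^ k) v) :
    -(3 * K ^ 2 * r) - 1 / 2 ≤ v := by
  have h4 := sum_range_sub_le_of_hasSum (A := 4 * N) (q := 7 / 8) (by norm_num) (by norm_num)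
    (fun k => ?_) hv K
  · have h5 : 4 * N * (7 / 8) ^ K / (1 - 7 / 8) ≤ 1 / 2 := by
      rw [div_le_iff₀ (by norm_num)]
      linarith
    have h6 : -(3 * K ^ 2 * r) ≤ ∑ k ∈ Finset.range K, (k + 1) * e (k + 1) * (1 + u) ^ k := by
      have h7 : ∀ k ∈ Finset.range K, -(3 * K * r) ≤ (k + 1) * e (k + 1) * (1 + u) ^ k := by
        intro k hk
        have hkK : k + 1 ≤ K := Finset.mem_range.mp hk
        have h8 := one_add_pow_le_three hu huK (Finset.mem_range.mp hk).le
        have h9 : 0 < (1 + u) ^ k := by positivity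
        have h10 : ((k : ℝ) + 1) ≤ K := by exact_mod_cast hkK
        have h11 : 0 ≤ (k + 1) * (e (k + 1) + r) * (1 + u) ^ k :=
          mul_nonneg (mul_nonneg (by positivity) (h1 _)) h9.le
        have h12 : (k + 1) * r * (1 + u) ^ k ≤ K * r * 3 := by gcongr
        nlinarith
      have h11 := Finset.sum_le_sum h7
      simp only [Finset.sum_const, Finset.card_range, nsmul_eq_mul] at h11
      linarith
    linarith
  · rw [abs_mul, abs_mul, abs_of_pos (show 0 < (1 + u) ^ k by positivity),
      abs_of_pos (show 0 < (k : ℝ) + 1 by positivity)]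
    have h5 : ((k : ℝ) + 1) ≤ 6 * (7 / 6) ^ k := by
      have := one_add_mul_le_pow (a := (1 / 6 : ℝ)) (by norm_num) k
      norm_num at this
      linarith
    calc _ ≤ (6 * (7 / 6) ^ k) * (N * (2 / 3) ^ (k + 1)) * (9 / 8) ^ k := by
          gcongr
          · exact h3 _
          · linarith
      _ = 4 * N * ((7 / 6) ^ k * (2 / 3) ^ k * (9 / 8) ^ k) := by rw [pow_succ]; ring
      _ = 4 * N * (7 / 8) ^ k := by rw [← mul_pow, ← mul_pow]; norm_num

end TaylorBounds

lemma exists_truncation {A : ℝ} (hA : 1 ≤ A) (m : ℕ) :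
    ∃ C : ℝ, 1 ≤ C ∧ ∀ D : ℕ, 3 ≤ D → ∃ K : ℕ, 1 ≤ K ∧
      32 * (A * (D : ℝ) ^ m) * (7 / 8) ^ K ≤ 1 / 2 ∧ (K : ℝ) ≤ C * Real.log D := by
  have hA0 : 0 ≤ Real.log (64 * A) := Real.log_nonneg (by linarith)
  have hm : (0 : ℝ) ≤ m := by positivity
  refine ⟨8 * Real.log (64 * A) + 8 * m + 2, by linarith, fun D hD => ?_⟩
  have hl := one_lt_log_of_three_le hD
  have hD0 : (1 : ℝ) ≤ D := by exact_mod_cast (by omega : 1 ≤ D)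
  set X : ℝ := 64 * A * (D : ℝ) ^ m with hX
  have hX0 : 0 < X := by positivity
  have hlX : Real.log X = Real.log (64 * A) + m * Real.log D := by
    rw [hX, Real.log_mul (by positivity) (by positivity), Real.log_pow]
  have hlX0 : 0 ≤ Real.log X := by rw [hlX]; positivity
  -- Since 7/8 ≤ e^(-1/8), 8 log X factors bring the product below 1/X.
  refine ⟨⌈8 * Real.log X⌉₊ + 1, by omega, ?_, ?_⟩
  · have h1 : ((7 : ℝ) / 8) ^ (⌈8 * Real.log X⌉₊ + 1) ≤ X⁻¹ := by
      calc ((7 : ℝ) / 8) ^ (⌈8 * Real.log X⌉₊ + 1)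
          ≤ Real.exp (-1 / 8) ^ (⌈8 * Real.log X⌉₊ + 1) := by
            gcongr
            linarith [Real.add_one_le_exp (-1 / 8 : ℝ)]
        _ = Real.exp ((⌈8 * Real.log X⌉₊ + 1 : ℕ) * (-1 / 8)) := by rw [← Real.exp_nat_mul]
        _ ≤ Real.exp (-Real.log X) := by
            apply Real.exp_le_exp.mpr
            have := Nat.le_ceil (8 * Real.log X)
            push_cast
            linarith
        _ = X⁻¹ := by rw [Real.exp_neg, Real.exp_log hX0]
    calc _ ≤ 32 * (A * (D : ℝ) ^ m) * X⁻¹ := by gcongr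
      _ = 1 / 2 := by rw [hX]; field_simp; norm_num
  · have := (Nat.ceil_lt_add_one (show 0 ≤ 8 * Real.log X by positivity)).le
    push_cast
    rw [hlX] at this ⊢
    nlinarith [mul_nonneg hA0 (sub_nonneg.mpr hl.le)]

lemma three_le_of_ne_one {D : ℕ} [NeZero D] {χ : DirichletCharacter ℂ D} (hχ : χ ≠ 1) :
    3 ≤ D := by
  by_contra! h
  have hD := NeZero.pos D
  refine hχ (MulChar.ext fun a => ?_)
  have ha : a = 1 := by
    interval_cases D
    · exact Subsingleton.elim _ _
    · revert a; decide
  rw [ha]; simp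

section LogSeries

variable {D : ℕ}

/-- The coefficients of the Dirichlet series of `log L(s, χ)`. -/
noncomputable def logCoeff (χ : DirichletCharacter ℂ D) (n : ℕ) : ℂ :=
  χ n * ArithmeticFunction.vonMangoldt n / Real.log n

/-- The coefficients of the Dirichlet series of `log ζ(s)`. -/
noncomputable def logCoeffZeta (n : ℕ) : ℂ :=
  ArithmeticFunction.vonMangoldt n / Real.log n

lemma logCoeff_eq (χ : DirichletCharacter ℂ D) (n : ℕ) :
    logCoeff χ n = χ n * logCoeffZeta n := by
  rw [logCoeff, logCoeffZeta, mul_div_assoc]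

lemma logCoeffZeta_nonneg (n : ℕ) : 0 ≤ logCoeffZeta n := by
  rw [logCoeffZeta, ← ofReal_div]
  exact_mod_cast div_nonneg ArithmeticFunction.vonMangoldt_nonneg (Real.log_natCast_nonneg n)

lemma norm_logCoeffZeta_le_one (n : ℕ) : ‖logCoeffZeta n‖ ≤ 1 := by
  rw [logCoeffZeta, ← ofReal_div, Complex.norm_real, Real.norm_of_nonneg
    (div_nonneg ArithmeticFunction.vonMangoldt_nonneg (Real.log_natCast_nonneg n))]
  exact vonMangoldt_div_log_le_one n

lemma norm_logCoeff_le_one (χ : DirichletCharacter ℂ D) (n : ℕ) : ‖logCoeff χ n‖ ≤ 1 := by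
  rw [logCoeff_eq, norm_mul]
  exact mul_le_one₀ (χ.norm_le_one _) (norm_nonneg _) (norm_logCoeffZeta_le_one n)

lemma summable_logCoeff (χ : DirichletCharacter ℂ D) {s : ℂ} (hs : 1 < s.re) :
    LSeriesSummable (logCoeff χ) s :=
  LSeriesSummable_of_bounded_of_one_lt_re (fun n _ => norm_logCoeff_le_one χ n) hs

lemma summable_logCoeffZeta {s : ℂ} (hs : 1 < s.re) : LSeriesSummable logCoeffZeta s :=
  LSeriesSummable_of_bounded_of_one_lt_re (fun n _ => norm_logCoeffZeta_le_one n) hs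

lemma exp_logCoeffZeta {s : ℂ} (hs : 1 < s.re) :
    exp (LSeries logCoeffZeta s) = riemannZeta s := riemannZeta_eq_exp_LSeries hs

lemma exp_logCoeff [NeZero D] (χ : DirichletCharacter ℂ D) {s : ℂ} (hs : 1 < s.re) :
    exp (LSeries (logCoeff χ) s) = χ.LFunction s := by
  rw [χ.LFunction_eq_LSeries hs]; exact χ.LSeries_eq_exp_LSeries hs

lemma one_add_apply_nonneg {χ : DirichletCharacter ℂ D} (hχ : χ ^ 2 = 1) (a : ZMod D) :
    0 ≤ 1 + χ a := by
  rcases apply_eq_zero_or_one_or_neg_one hχ a with h | h | h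
  · simp [h]
  · rw [h]; norm_num
  · simp [h]

end LogSeries

end QuadraticLOne

/-! ### The lower bound for L(1,χ), and the Landau–Page theorem. -/

namespace QuadraticLOne

open Complex Filter Topology
open scoped ComplexOrder

section

variable {D : ℕ}

lemma logCoeff_two_nonneg {χ : DirichletCharacter ℂ D} (hχ : χ ^ 2 = 1) :
    0 ≤ logCoeffZeta + logCoeff χ := fun n => by
  have : (logCoeffZeta + logCoeff χ) n = (1 + χ n) * logCoeffZeta n := by
    rw [Pi.add_apply, logCoeff_eq]; ring
  rw [this]
  exact mul_nonneg (one_add_apply_nonneg hχ _) (logCoeffZeta_nonneg n)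

/-- The factor χ₁χ₂ is included so that the coefficients factor through (1+χ₁)(1+χ₂) ≥ 0. -/
lemma logCoeff_four_nonneg {χ₁ χ₂ : DirichletCharacter ℂ D} (h₁ : χ₁ ^ 2 = 1) (h₂ : χ₂ ^ 2 = 1) :
    0 ≤ logCoeffZeta + logCoeff χ₁ + logCoeff χ₂ + logCoeff (χ₁ * χ₂) := fun n => by
  have : (logCoeffZeta + logCoeff χ₁ + logCoeff χ₂ + logCoeff (χ₁ * χ₂)) n =
      (1 + χ₁ n) * (1 + χ₂ n) * logCoeffZeta n := by
    simp only [Pi.add_apply, logCoeff_eq, MulChar.mul_apply]; ring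
  rw [this]
  exact mul_nonneg (mul_nonneg (one_add_apply_nonneg h₁ _) (one_add_apply_nonneg h₂ _))
    (logCoeffZeta_nonneg n)

variable [NeZero D]

/-- A quadratic character without exceptional zero does not change sign on
`(1 - c₀ / log D, 1]`. -/
lemma LFunction_re_nonneg_of_not_hasExceptionalZero {c₀ : ℝ} {χ : DirichletCharacter ℂ D}
    (hχ : IsQuadraticChar χ) (hz : ¬ HasExceptionalZero c₀ χ) {x : ℝ} (hx0 : 0 < x) (hx1 : x ≤ 1)
    (hx : 1 - c₀ / Real.log D < x) : 0 ≤ (χ.LFunction x).re := by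
  by_contra! hneg
  have hc : Continuous fun x : ℝ => (χ.LFunction x).re :=
    continuous_re.comp ((DirichletCharacter.differentiable_LFunction hχ.1).continuous.comp
      continuous_ofReal)
  have h1 : 0 < (χ.LFunction (1 : ℝ)).re := by
    rw [ofReal_one]; exact LFunction_one_re_pos hχ
  obtain ⟨y, hy, hy0⟩ := intermediate_value_Icc hx1 hc.continuousOn ⟨hneg.le, h1.le⟩
  refine hz ⟨y, hx.trans_le hy.1, ?_⟩
  have := ofReal_re_LFunction hχ (hx0.trans_le hy.1)
  rw [← this]
  exact_mod_cast hy0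

lemma LFunction_one_eq_LOne {χ : DirichletCharacter ℂ D} (hχ : IsQuadraticChar χ) :
    χ.LFunction 1 = ((LOne χ : ℝ) : ℂ) := by
  have := ofReal_re_LFunction hχ zero_lt_one
  rw [ofReal_one] at this
  exact this.symm

lemma LOne_pos {χ : DirichletCharacter ℂ D} (hχ : IsQuadraticChar χ) : 0 < LOne χ :=
  LFunction_one_re_pos hχ

lemma zeta_mul_LFunction_eq_exp (χ : DirichletCharacter ℂ D) {s : ℂ} (hs : 1 < s.re) :
    riemannZeta s * χ.LFunction s = exp (LSeries (logCoeffZeta + logCoeff χ) s) := by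
  rw [LSeries_add (summable_logCoeffZeta hs) (summable_logCoeff χ hs), exp_add,
    exp_logCoeffZeta hs, exp_logCoeff χ hs]

lemma zeta_mul_three_LFunction_eq_exp (χ₁ χ₂ : DirichletCharacter ℂ D) {s : ℂ} (hs : 1 < s.re) :
    riemannZeta s * (χ₁.LFunction s * χ₂.LFunction s * (χ₁ * χ₂).LFunction s) =
      exp (LSeries (logCoeffZeta + logCoeff χ₁ + logCoeff χ₂ + logCoeff (χ₁ * χ₂)) s) := by
  have h0 := summable_logCoeffZeta hs
  have h1 := summable_logCoeff χ₁ hs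
  have h2 := summable_logCoeff χ₂ hs
  have h3 := summable_logCoeff (χ₁ * χ₂) hs
  rw [LSeries_add ((h0.add h1).add h2) h3, LSeries_add (h0.add h1) h2, LSeries_add h0 h1,
    exp_add, exp_add, exp_add, exp_logCoeffZeta hs, exp_logCoeff χ₁ hs, exp_logCoeff χ₂ hs,
    exp_logCoeff _ hs]
  ring

end

/-- A quadratic character without exceptional zero satisfies `L(1, χ) ≫ 1 / log D`. -/
theorem exists_le_LOne {c₀ : ℝ} (hc₀ : 0 < c₀) :
    ∃ c : ℝ, 0 < c ∧ ∀ (D : ℕ) [NeZero D] (χ : DirichletCharacter ℂ D), IsQuadraticChar χ →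
      ¬ HasExceptionalZero c₀ χ → c / Real.log D ≤ LOne χ := by
  obtain ⟨B, hB1, hB⟩ := exists_norm_riemannZeta₀_le
  obtain ⟨C, hC1, hC⟩ := exists_norm_LFunction_le_modulus
  obtain ⟨C₁, hC₁1, hC₁⟩ := exists_truncation (A := (B + 4) * C) (by nlinarith) 1
  -- For u = κ/log D these conditions place 1-u where no zero is allowed, give u ≤ 1/8 and uK ≤ 1/3,
  -- and make ζ(1-u) ≤ 0.
  set κ : ℝ := min (min (c₀ / 2) (1 / 8)) (min (1 / (3 * C₁)) (1 / B))
  have hκ0 : 0 < κ := by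
    refine lt_min (lt_min ?_ ?_) (lt_min ?_ ?_) <;> positivity
  have hκ1 : κ ≤ c₀ / 2 := (min_le_left _ _).trans (min_le_left _ _)
  have hκ2 : κ ≤ 1 / 8 := (min_le_left _ _).trans (min_le_right _ _)
  have hκ3 : κ ≤ 1 / (3 * C₁) := (min_le_right _ _).trans (min_le_left _ _)
  have hκ4 : κ ≤ 1 / B := (min_le_right _ _).trans (min_le_right _ _)
  refine ⟨κ / 4, by positivity, fun D _ χ hχ hz => ?_⟩
  have hD := three_le_of_ne_one hχ.1
  have hl := one_lt_log_of_three_le hD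
  obtain ⟨K, hK1, hK2, hK3⟩ := hC₁ D hD
  set l := Real.log D
  set u := κ / l with hu
  have hl0 : 0 < l := by linarith
  have hu0 : 0 < u := by positivity
  have huκ : u ≤ κ := div_le_self hκ0.le hl.le
  have huK : u * K ≤ 1 / 3 := by
    calc u * K ≤ κ / l * (C₁ * l) := by gcongr
      _ = κ * C₁ := by field_simp
      _ ≤ 1 / (3 * C₁) * C₁ := by gcongr
      _ = 1 / 3 := by field_simp
  have hr := LOne_pos hχ
  obtain ⟨e, he1, he2, he3, he4⟩ := exists_taylor_coeff hB (logCoeff_two_nonneg hχ.2)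
    (LSeries.abscissaOfAbsConv_le_of_le_const ⟨2, fun n _ =>
      (norm_add_le_of_le (norm_logCoeffZeta_le_one n) (norm_logCoeff_le_one χ n)).trans
        (by norm_num)⟩)
    (DirichletCharacter.differentiable_LFunction hχ.1)
    (fun s hs => zeta_mul_LFunction_eq_exp χ hs) (LFunction_one_eq_LOne hχ) (hC D χ hχ.1)
  have h5 := half_sub_le_of_hasSum hr.le he1 he2 (by positivity) he3
    (by rw [pow_one] at hK2; linarith) hK1 hu0 (huκ.trans hκ2) huK (he4 u hu0).1
  -- Here ζ(1-u) ≤ -1/u + B ≤ 0, while L(1-u,χ) ≥ 0.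
  have h6 : (riemannZeta (1 - u) * χ.LFunction (1 - u)).re ≤ 0 := by
    have h7 : 0 ≤ (χ.LFunction ((1 - u : ℝ) : ℂ)).re := by
      refine LFunction_re_nonneg_of_not_hasExceptionalZero hχ hz (by linarith) (by linarith) ?_
      have : u < c₀ / l := by rw [hu]; gcongr; linarith
      linarith
    have h8 := ofReal_re_LFunction hχ (show 0 < 1 - u by linarith)
    rw [show (1 : ℂ) - u = ((1 - u : ℝ) : ℂ) by push_cast; ring, ← h8, re_mul_ofReal]
    refine mul_nonpos_of_nonpos_of_nonneg ?_ h7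
    have hne : ((1 - u : ℝ) : ℂ) ≠ 1 := by
      rw [← ofReal_one, Ne, ofReal_inj]; linarith
    have h9 := (abs_re_le_norm _).trans (hB ((1 - u : ℝ) : ℂ) (by
      rw [Metric.mem_closedBall, dist_eq_norm, ← ofReal_ofNat, ← ofReal_sub, Complex.norm_real,
        Real.norm_eq_abs, abs_le]
      constructor <;> linarith))
    have h10 := (abs_le.mp h9).2
    rw [riemannZeta_eq_inv_sub_add hne, add_re, ← ofReal_one, ← ofReal_sub, ← ofReal_inv,
      ofReal_re, sub_sub_cancel_left, inv_neg]
    have h11 : B ≤ u⁻¹ := by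
      rw [le_inv_comm₀ (by linarith) hu0, ← one_div]; exact huκ.trans hκ4
    linarith
  have h7 : 1 / 2 ≤ 2 * LOne χ / u := by
    have h8 : 3 * (K : ℝ) ≤ 1 / u := by rw [le_div_iff₀ hu0]; linarith
    have h9 := mul_le_mul_of_nonneg_right h8 hr.le
    have h10 : 2 * LOne χ / u = 1 / u * LOne χ + LOne χ / u := by
      field_simp; ring
    linarith
  calc κ / 4 / l = u / 4 := by rw [hu]; ring
    _ ≤ LOne χ := by
      rw [div_le_div_iff₀ (by norm_num) hu0] at h7
      linarith

/-- Two zeros of `L(s, χ₁)` and `L(s, χ₂)` give a critical point of `Re (ζ L L L)` between them. -/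
lemma exists_deriv_re_eq_zero {G : ℂ → ℂ} {P : ℂ → ℂ} {f g k : ℂ → ℂ} (hf : Differentiable ℂ f)
    (hg : Differentiable ℂ g) (hk : Differentiable ℂ k) (hP : ∀ s, P s = f s * g s * k s)
    (hG : ∀ s, G s = riemannZeta s * P s)
    {a b : ℝ} (hab : a ≤ b) (hb1 : b < 1) (ha : f a = 0) (hb : g b = 0) :
    ∃ x ∈ Set.Icc a b, (deriv G x).re = 0 := by
  have hGe : G = fun s => riemannZeta s * (f s * g s * k s) := by
    funext s; rw [hG, hP]
  have hd : ∀ x : ℝ, x < 1 → DifferentiableAt ℂ G x := fun x hx => by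
    rw [hGe]
    refine (differentiableAt_riemannZeta ?_).mul (((hf _).mul (hg _)).mul (hk _))
    rw [← ofReal_one, Ne, ofReal_inj]; exact hx.ne
  rcases hab.eq_or_lt with h | h
  -- When the zeros coincide, their product has a double zero, so the derivative vanishes there.
  · subst h
    refine ⟨a, ⟨le_rfl, le_rfl⟩, ?_⟩
    have hζ : DifferentiableAt ℂ riemannZeta a := differentiableAt_riemannZeta (by
      rw [← ofReal_one, Ne, ofReal_inj]; exact hb1.ne)
    have h1 := hζ.hasDerivAt.mul (((hf a).hasDerivAt.mul (hg a).hasDerivAt).mul (hk a).hasDerivAt)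
    have h2 : G = riemannZeta * (f * g * k) := by rw [hGe]; rfl
    rw [h2, h1.deriv]
    simp [ha, hb]
  · have hdr : ∀ x : ℝ, x < 1 → HasDerivAt (fun x : ℝ => (G x).re) (deriv G x).re x :=
      fun x hx => (hd x hx).hasDerivAt.real_of_complex
    obtain ⟨x, hx, hx0⟩ := exists_deriv_eq_zero (f := fun x : ℝ => (G x).re) h
      (fun x hx => (hdr x (hx.2.trans_lt hb1)).continuousAt.continuousWithinAt)
      (by simp [hGe, ha, hb])
    exact ⟨x, Set.Ioo_subset_Icc_self hx, by rw [← hx0, (hdr x (hx.2.trans hb1)).deriv]⟩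

/-- **Landau–Page**: for a suitable absolute constant, at most one quadratic character of a given
modulus has an exceptional zero. -/
theorem exists_isExceptionalConstant : ∃ c₀ : ℝ, IsExceptionalConstant c₀ := by
  obtain ⟨B, hB1, hB⟩ := exists_norm_riemannZeta₀_le
  obtain ⟨C, hC1, hC⟩ := exists_norm_LFunction_le_modulus
  obtain ⟨C₁, hC₁1, hC₁⟩ := exists_truncation (A := (B + 4) * C ^ 3)
    (by nlinarith [one_le_pow₀ (n := 3) hC1]) 3
  set κ : ℝ := min (1 / 8) (1 / (3 * C₁))
  have hκ0 : 0 < κ := by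
    refine lt_min ?_ ?_ <;> positivity
  have hκ2 : κ ≤ 1 / 8 := min_le_left _ _
  have hκ3 : κ ≤ 1 / (3 * C₁) := min_le_right _ _
  suffices key : ∀ (D : ℕ) [NeZero D] (χ₁ χ₂ : DirichletCharacter ℂ D),
      IsQuadraticChar χ₁ → IsQuadraticChar χ₂ → χ₁ ≠ χ₂ → ∀ a b : ℝ, a ≤ b →
        1 - κ / Real.log D < a → χ₁.LFunction a = 0 → χ₂.LFunction b = 0 → False by
    refine ⟨κ, hκ0, fun D _ χ₁ χ₂ h₁ h₂ ⟨a, ha, ha0⟩ ⟨b, hb, hb0⟩ => ?_⟩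
    by_contra hne
    rcases le_total a b with hab | hab
    · exact key D χ₁ χ₂ h₁ h₂ hne a b hab ha ha0 hb0
    · exact key D χ₂ χ₁ h₂ h₁ (Ne.symm hne) b a hab hb hb0 ha0
  intro D _ χ₁ χ₂ h₁ h₂ hne a b hab ha ha0 hb0
  have hD := three_le_of_ne_one h₁.1
  have hl := one_lt_log_of_three_le hD
  have h₃ : IsQuadraticChar (χ₁ * χ₂) := by
    refine ⟨fun h => hne ?_, by rw [mul_pow, h₁.2, h₂.2, one_mul]⟩
    have h4 : χ₂ * χ₂ = 1 := by rw [← sq, h₂.2]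
    calc χ₁ = χ₁ * (χ₂ * χ₂) := by rw [h4, mul_one]
      _ = χ₂ := by rw [← mul_assoc, h, one_mul]
  have hb1 : b < 1 := by
    by_contra! h
    exact DirichletCharacter.LFunction_ne_zero_of_one_le_re χ₂ (Or.inl h₂.1)
      (show 1 ≤ (b : ℂ).re by simpa using h) hb0
  obtain ⟨K, hK1, hK2, hK3⟩ := hC₁ D hD
  set l := Real.log D
  have hl0 : 0 < l := by linarith
  have hκl : κ / l ≤ κ := div_le_self hκ0.le hl.le
  have huK : ∀ u, u ≤ κ / l → u * K ≤ 1 / 3 := fun u hu => by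
    calc u * K ≤ κ / l * (C₁ * l) := by gcongr
      _ = κ * C₁ := by field_simp
      _ ≤ 1 / (3 * C₁) * C₁ := by gcongr
      _ = 1 / 3 := by field_simp
  set P : ℂ → ℂ := fun s => χ₁.LFunction s * χ₂.LFunction s * (χ₁ * χ₂).LFunction s with hP
  have hd₁ := DirichletCharacter.differentiable_LFunction h₁.1
  have hd₂ := DirichletCharacter.differentiable_LFunction h₂.1
  have hd₃ := DirichletCharacter.differentiable_LFunction h₃.1
  set r := LOne χ₁ * LOne χ₂ * LOne (χ₁ * χ₂) with hr
  have hr0 : 0 < r := mul_pos (mul_pos (LOne_pos h₁) (LOne_pos h₂)) (LOne_pos h₃)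
  have hPr : P 1 = r := by
    simp only [hP, hr]
    rw [LFunction_one_eq_LOne h₁, LFunction_one_eq_LOne h₂, LFunction_one_eq_LOne h₃]
    push_cast; ring
  have hPM : ∀ s ∈ Metric.closedBall (2 : ℂ) (3 / 2), ‖P s‖ ≤ C ^ 3 * (D : ℝ) ^ 3 := by
    intro s hs
    simp only [hP]
    rw [norm_mul, norm_mul]
    calc _ ≤ (C * D) * (C * D) * (C * D) := by
          gcongr
          · exact hC D χ₁ h₁.1 s hs
          · exact hC D χ₂ h₂.1 s hs
          · exact hC D _ h₃.1 s hs
      _ = _ := by ring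
  obtain ⟨e, he1, he2, he3, he4⟩ := exists_taylor_coeff (P := P) hB (logCoeff_four_nonneg h₁.2 h₂.2)
    (LSeries.abscissaOfAbsConv_le_of_le_const ⟨1 + 1 + 1 + 1, fun n _ =>
      norm_add_le_of_le (norm_add_le_of_le (norm_add_le_of_le (norm_logCoeffZeta_le_one n)
        (norm_logCoeff_le_one χ₁ n)) (norm_logCoeff_le_one χ₂ n)) (norm_logCoeff_le_one _ n)⟩)
    ((hd₁.mul hd₂).mul hd₃)
    (fun s hs => zeta_mul_three_LFunction_eq_exp χ₁ χ₂ hs) hPr hPM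
  have hN : 0 ≤ (B + 4) * (C ^ 3 * (D : ℝ) ^ 3) := by positivity
  have hK2' : 32 * ((B + 4) * (C ^ 3 * (D : ℝ) ^ 3)) * (7 / 8) ^ K ≤ 1 / 2 := by
    rw [← mul_assoc (B + 4)]; exact hK2
  obtain ⟨x, ⟨hax, hxb⟩, hx0⟩ := exists_deriv_re_eq_zero (P := P)
    (G := fun s => riemannZeta s * P s) hd₁ hd₂ hd₃ (fun _ => rfl) (fun _ => rfl) hab hb1 ha0 hb0
  -- the zero `a` bounds `r` from below
  have hlow : 1 / 2 ≤ 2 * r / (1 - a) := by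
    have hu0 : 0 < 1 - a := by linarith
    have h5 := half_sub_le_of_hasSum hr0.le he1 he2 hN he3 hK2' hK1 hu0 (by linarith)
      (huK _ (by linarith)) (he4 _ hu0).1
    have h6 : P (1 - ((1 - a : ℝ) : ℂ)) = 0 := by
      rw [ofReal_sub, ofReal_one, sub_sub_cancel]
      simp [hP, ha0]
    rw [h6, mul_zero, zero_re, zero_add] at h5
    have h8 : 3 * (K : ℝ) ≤ 1 / (1 - a) := by
      rw [le_div_iff₀ hu0]; linarith [huK (1 - a) (by linarith)]
    have h9 := mul_le_mul_of_nonneg_right h8 hr0.le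
    have h10 : 2 * r / (1 - a) = 1 / (1 - a) * r + r / (1 - a) := by ring
    linarith
  -- the critical point `x` bounds `r` from above
  set u := 1 - x with hu
  have hu0 : 0 < u := by linarith
  have h5 := neg_le_of_hasSum_deriv hr0.le he1 hN he3 hK2' hu0 (by linarith)
    (huK _ (by linarith)) (he4 _ hu0).2
  have h6 : (1 : ℂ) - u = x := by rw [hu]; push_cast; ring
  rw [h6, hx0, neg_zero, zero_sub] at h5
  have h7 : 3 * (K : ℝ) ^ 2 * r ≤ r / (3 * u ^ 2) := by
    rw [le_div_iff₀ (by positivity)]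
    have h8 := huK u (by linarith)
    have h9 : (u * K) ^ 2 ≤ (1 / 3) ^ 2 := by gcongr
    nlinarith
  have h8 : r / u ^ 2 - r / (3 * u ^ 2) = 2 / 3 * r / u ^ 2 := by field_simp; norm_num
  have h9 : 2 / 3 * r / u ^ 2 ≤ 1 / 2 := by linarith
  rw [div_le_iff₀ (by positivity)] at h9
  rw [le_div_iff₀ (by linarith)] at hlow
  have h10 : u ≤ 1 - a := by linarith
  have h11 : u ≤ 1 / 8 := by linarith
  -- The bounds (1-a)/4 ≤ r ≤ 3u²/4 contradict u ≤ 1-a and u ≤ 1/8.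
  nlinarith

end QuadraticLOne

/-! ### Comparing log L(1,χ) with log L(1+t,χ). -/

namespace QuadraticLOne

open Complex Filter Topology

/-- Moving from 1 to 1+t changes L by O(t(log D)²), which for t ≤ ε/(log D)³ is at most half of
L(1,χ) ≫ 1/log D. The second bound also uses L(1,χ) ≪ log D. -/
lemma exists_abs_logL_le {c₀ : ℝ} (hc₀ : 0 < c₀) :
    ∃ ε C : ℝ, 0 < ε ∧ ε ≤ 1 ∧ 0 ≤ C ∧ ∀ (D : ℕ) [NeZero D] (χ : DirichletCharacter ℂ D),
      IsQuadraticChar χ → ¬ HasExceptionalZero c₀ χ → ∀ t : ℝ, 0 < t → t ≤ ε / Real.log D ^ 3 →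
        |logL χ (1 + t) - Real.log (LOne χ)| ≤ 1 ∧
        |logL χ (1 + t)| ≤ Real.log (Real.log D) + C := by
  obtain ⟨c, hc0, hc⟩ := exists_le_LOne hc₀
  obtain ⟨C₂, hC₂1, hC₂⟩ := exists_norm_LFunction_sub_le
  obtain ⟨C₃, hC₃1, hC₃⟩ := exists_norm_LFunction_le_log
  refine ⟨min (1 / 4) (c / (2 * C₂)), |Real.log c| + |Real.log C₃| + 1,
    lt_min (by norm_num) (by positivity), (min_le_left _ _).trans (by norm_num), by positivity,
    fun D _ χ hχ hz t ht0 ht => ?_⟩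
  have hD := three_le_of_ne_one hχ.1
  have hl := one_lt_log_of_three_le hD
  have hLpos := LOne_pos hχ
  have hLlow := hc D χ hχ hz
  have hLup : LOne χ ≤ C₃ * Real.log D :=
    (re_le_norm _).trans (hC₃ D χ hD hχ.1 1 (by simpa using (zero_lt_one.trans hl).le))
  set l := Real.log D
  have hl0 : 0 < l := by linarith
  have hl3 : 1 ≤ l ^ 2 := one_le_pow₀ hl.le
  have ht1 : t ≤ 1 / (4 * l) := by
    calc t ≤ (1 / 4) / l ^ 3 := ht.trans (by gcongr; exact min_le_left _ _)
      _ ≤ (1 / 4) / l := by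
        gcongr
        calc l = l ^ 1 := (pow_one l).symm
          _ ≤ l ^ 3 := pow_le_pow_right₀ hl.le (by norm_num)
      _ = _ := by field_simp
  have hdiff : |Real.exp (logL χ (1 + t)) - LOne χ| ≤ LOne χ / 2 := by
    have h1 := hC₂ D χ hD hχ.1 (1 + t) (by linarith) (by linarith)
    rw [LFunction_eq_exp_logL hχ.2 (by linarith), LFunction_one_eq_LOne hχ, ← ofReal_sub,
      Complex.norm_real, Real.norm_eq_abs] at h1
    refine h1.trans ?_
    calc C₂ * l ^ 2 * (1 + t - 1) ≤ C₂ * l ^ 2 * ((c / (2 * C₂)) / l ^ 3) := by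
          have : t ≤ (c / (2 * C₂)) / l ^ 3 := ht.trans (by gcongr; exact min_le_right _ _)
          rw [add_sub_cancel_left]; gcongr
      _ = c / l / 2 := by field_simp
      _ ≤ _ := by gcongr
  have h1 : |logL χ (1 + t) - Real.log (LOne χ)| ≤ 1 := by
    have h2 := abs_le.mp hdiff
    have he := Real.exp_one_gt_d9
    rw [abs_le]
    constructor
    · have : Real.log (LOne χ) ≤ Real.log (Real.exp 1 * Real.exp (logL χ (1 + t))) := by
        apply Real.log_le_log hLpos
        nlinarith [h2.1]
      rw [← Real.exp_add, Real.log_exp] at this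
      linarith
    · have : Real.log (Real.exp (logL χ (1 + t))) ≤ Real.log (Real.exp 1 * LOne χ) := by
        apply Real.log_le_log (Real.exp_pos _)
        nlinarith [h2.2]
      rw [Real.log_exp, Real.log_mul (Real.exp_pos _).ne' hLpos.ne', Real.log_exp] at this
      linarith
  refine ⟨h1, ?_⟩
  have h3 : |Real.log (LOne χ)| ≤ Real.log l + |Real.log c| + |Real.log C₃| := by
    have h4 := Real.log_le_log (by positivity) hLlow
    have h5 := Real.log_le_log hLpos hLup
    rw [Real.log_div hc0.ne' hl0.ne'] at h4
    rw [Real.log_mul (by positivity) hl0.ne'] at h5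
    have h6 := neg_abs_le (Real.log c)
    have h7 := le_abs_self (Real.log C₃)
    have h8 := abs_nonneg (Real.log c)
    have h9 := abs_nonneg (Real.log C₃)
    rw [abs_le]
    constructor <;> linarith
  have h4 := abs_add_le (logL χ (1 + t) - Real.log (LOne χ)) (Real.log (LOne χ))
  rw [sub_add_cancel] at h4
  linarith

/-- Comparison with log ζ(1+t), valid for every character; it serves for the principal and
exceptional ones. -/
lemma exists_abs_logL_le_log :
    ∃ C : ℝ, 1 ≤ C ∧ ∀ (D : ℕ) (χ : DirichletCharacter ℂ D) (t : ℝ), 0 < t → t ≤ 1 →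
      |logL χ (1 + t)| ≤ Real.log (C / t) := by
  obtain ⟨C, hC1, hC⟩ := exists_tsum_succ_rpow_le
  refine ⟨C, hC1, fun D χ t ht0 ht1 => ?_⟩
  have hx : 1 < 1 + t := by linarith
  refine (abs_logL_le χ hx).trans ?_
  rw [Real.le_log_iff_exp_le (by positivity), exp_tsum_logWeight hx]
  have := hC (1 + t) hx (by linarith)
  rwa [add_sub_cancel_left] at this

/-! ### Orthogonality and the number of real characters. -/

/-- The group of real characters modulo `D`. -/
noncomputable def realChars (D : ℕ) [NeZero D] : Finset (DirichletCharacter ℂ D) :=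
  (Set.toFinite {χ : DirichletCharacter ℂ D | χ ^ 2 = 1}).toFinset

section Orthogonality

variable {D : ℕ} [NeZero D]

lemma mem_realChars {χ : DirichletCharacter ℂ D} : χ ∈ realChars D ↔ χ ^ 2 = 1 := by
  simp [realChars]

lemma one_mem_realChars : (1 : DirichletCharacter ℂ D) ∈ realChars D :=
  mem_realChars.mpr (one_pow 2)

/-- Multiplication by some ψ with ψ(a) ≠ 1 permutes the group and rescales the sum by ψ(a). -/
lemma sum_realChars_eq_zero_or (a : ZMod D) :
    ∑ χ ∈ realChars D, χ a = 0 ∨ ∀ χ ∈ realChars D, χ a = 1 := by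
  by_cases h : ∀ χ ∈ realChars D, χ a = 1
  · exact Or.inr h
  left
  push Not at h
  obtain ⟨ψ, hψ, hψa⟩ := h
  have hψ2 : ψ * ψ = 1 := by rw [← sq, mem_realChars.mp hψ]
  have hmul : ∀ χ ∈ realChars D, ψ * χ ∈ realChars D := fun χ hχ => by
    rw [mem_realChars, mul_pow, mem_realChars.mp hψ, mem_realChars.mp hχ, one_mul]
  have h1 : ∑ χ ∈ realChars D, χ a = ψ a * ∑ χ ∈ realChars D, χ a := by
    rw [Finset.mul_sum]
    refine Finset.sum_bij' (fun χ _ => ψ * χ) (fun χ _ => ψ * χ) hmul hmul ?_ ?_ ?_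
    · intro χ _; rw [← mul_assoc, hψ2, one_mul]
    · intro χ _; rw [← mul_assoc, hψ2, one_mul]
    · intro χ _
      rw [← MulChar.mul_apply, ← mul_assoc, hψ2, one_mul]
  have h2 : (ψ a - 1) * ∑ χ ∈ realChars D, χ a = 0 := by rw [sub_mul, one_mul, ← h1, sub_self]
  exact (mul_eq_zero.mp h2).resolve_left (sub_ne_zero.mpr hψa)

/-- A comparison of averages with denominators cleared. If the average modulo D is nonzero, then n
is a unit modulo D, and every real ψ modulo D' lifts to a real character modulo D with the same
value at n. -/
lemma card_mul_sum_re_le {D' : ℕ} [NeZero D'] (hD : D' ∣ D) (n : ℕ) :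
    (realChars D').card * ∑ χ ∈ realChars D, (χ (n : ZMod D)).re ≤
      (realChars D).card * ∑ ψ ∈ realChars D', (ψ (n : ZMod D')).re := by
  rcases sum_realChars_eq_zero_or (D := D) n with h | h
  · rw [← re_sum, h, zero_re, mul_zero, ← re_sum]
    refine mul_nonneg (Nat.cast_nonneg _) ?_
    rcases sum_realChars_eq_zero_or (D := D') n with h' | h'
    · rw [h', zero_re]
    · rw [Finset.sum_congr rfl h']; simp
  · have hn : IsUnit (n : ZMod D) := by
      by_contra hn
      have := h 1 one_mem_realChars
      rw [MulChar.map_nonunit _ hn] at this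
      exact zero_ne_one this
    have h' : ∀ ψ ∈ realChars D', ψ (n : ZMod D') = 1 := fun ψ hψ => by
      have h1 : DirichletCharacter.changeLevel hD ψ ∈ realChars D := by
        rw [mem_realChars, ← map_pow, mem_realChars.mp hψ, map_one]
      have h2 := DirichletCharacter.changeLevel_eq_cast_of_dvd ψ hD hn.unit
      rw [hn.unit_spec, h _ h1, ZMod.cast_natCast hD] at h2
      exact h2.symm
    rw [Finset.sum_congr rfl (fun χ hχ => congrArg re (h χ hχ)),
      Finset.sum_congr rfl (fun ψ hψ => congrArg re (h' ψ hψ))]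
    simp [mul_comm]

lemma sum_realChars_sq (w : ℕ → ℝ) (N : ℕ) :
    ∑ χ ∈ realChars D, (∑ n ∈ Finset.range N, (χ (n : ZMod D)).re * w n) ^ 2 =
      ∑ m ∈ Finset.range N, ∑ n ∈ Finset.range N,
        w m * w n * ∑ χ ∈ realChars D, (χ ((m * n : ℕ) : ZMod D)).re := by
  have h : ∀ χ ∈ realChars D, (∑ n ∈ Finset.range N, (χ (n : ZMod D)).re * w n) ^ 2 =
      ∑ m ∈ Finset.range N, ∑ n ∈ Finset.range N,
        w m * w n * (χ ((m * n : ℕ) : ZMod D)).re := fun χ hχ => by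
    rw [sq, Finset.sum_mul_sum]
    refine Finset.sum_congr rfl fun m _ => Finset.sum_congr rfl fun n _ => ?_
    rw [Nat.cast_mul, map_mul, ← ofReal_re_apply (mem_realChars.mp hχ) (m : ZMod D), re_ofReal_mul,
      ofReal_re]
    ring
  rw [Finset.sum_congr rfl h, Finset.sum_comm]
  refine Finset.sum_congr rfl fun m _ => ?_
  rw [Finset.sum_comm]
  refine Finset.sum_congr rfl fun n _ => ?_
  rw [Finset.mul_sum]

/-- The mean square of `log L(x, χ)` over the real characters modulo `D` is at most the mean square
over the real characters modulo a divisor. -/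
lemma card_mul_sum_logL_sq_le {D' : ℕ} [NeZero D'] (hD : D' ∣ D) {x : ℝ} (hx : 1 < x) :
    (realChars D').card * ∑ χ ∈ realChars D, logL χ x ^ 2 ≤
      (realChars D).card * ∑ ψ ∈ realChars D', logL ψ x ^ 2 := by
  -- Expanding squares of partial sums keeps all rearrangements finite; the inequality then passes
  -- to the limit.
  have hlim : ∀ (M : ℕ) [NeZero M], Tendsto (fun N => ∑ χ ∈ realChars M,
      (∑ n ∈ Finset.range N, (χ (n : ZMod M)).re * logWeight x n) ^ 2) atTop
      (𝓝 (∑ χ ∈ realChars M, logL χ x ^ 2)) := fun M _ =>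
    tendsto_finsetSum _ fun χ _ =>
      (summable_re_mul_logWeight χ hx).hasSum.tendsto_sum_nat.pow 2
  refine le_of_tendsto_of_tendsto' ((hlim D).const_mul _) ((hlim D').const_mul _) fun N => ?_
  rw [sum_realChars_sq, sum_realChars_sq, Finset.mul_sum, Finset.mul_sum]
  refine Finset.sum_le_sum fun m _ => ?_
  rw [Finset.mul_sum, Finset.mul_sum]
  refine Finset.sum_le_sum fun n _ => ?_
  have h1 := mul_le_mul_of_nonneg_left (card_mul_sum_re_le hD (m * n))
    (mul_nonneg (logWeight_nonneg x m) (logWeight_nonneg x n))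
  linarith

end Orthogonality

/-- By the Chinese remainder theorem each vector of signs gives a unit of square 1, distinct because
the primes are odd. The character group is isomorphic to the unit group, so these give real
characters. -/
lemma two_pow_card_le_card_realChars (S : Finset ℕ) (hS : ∀ p ∈ S, p.Prime ∧ p ≠ 2) {D : ℕ}
    [NeZero D] (hD : D = ∏ i : S, (i : ℕ)) : 2 ^ S.card ≤ (realChars D).card := by
  subst hD
  set D := ∏ i : S, (i : ℕ)
  have hcop : Pairwise (Function.onFun Nat.Coprime fun i : S => (i : ℕ)) := fun i j hij =>
    (Nat.coprime_primes (hS i i.2).1 (hS j j.2).1).mpr fun h => hij (Subtype.ext h)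
  let e : (ZMod D)ˣ ≃* ((i : S) → (ZMod (i : ℕ))ˣ) :=
    (Units.mapEquiv (ZMod.prodEquivPi _ hcop).toMulEquiv).trans MulEquiv.piUnits
  let g : (DirichletCharacter ℂ D) ≃* (ZMod D)ˣ :=
    (DirichletCharacter.mulEquiv_units ℂ D).some
  let F : (S → ℤˣ) → DirichletCharacter ℂ D := fun f =>
    g.symm (e.symm fun i => Units.map (Int.castRingHom (ZMod (i : ℕ))).toMonoidHom (f i))
  have hFinj : Function.Injective F := by
    intro f₁ f₂ h
    have h1 := e.symm.injective (g.symm.injective h)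
    funext i
    have h2 := congrFun h1 i
    have hp : 2 < (i : ℕ) := by
      have := hS i i.2
      have := this.1.two_le
      omega
    have : Fact (2 < (i : ℕ)) := ⟨hp⟩
    have h3 := congrArg Units.val h2
    rcases Int.units_eq_one_or (f₁ i) with ha | ha <;>
      rcases Int.units_eq_one_or (f₂ i) with hb | hb <;> rw [ha, hb] at h3 ⊢
    · exact absurd h3.symm (by simpa using ZMod.neg_one_ne_one)
    · exact absurd h3 (by simpa using ZMod.neg_one_ne_one)
  have hFmem : ∀ f, F f ∈ realChars D := fun f => by
    rw [mem_realChars]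
    simp only [F]
    rw [← map_pow, ← map_pow, map_eq_one_iff _ g.symm.injective, map_eq_one_iff _ e.symm.injective]
    funext i
    rw [Pi.pow_apply, ← map_pow, Int.units_sq, map_one, Pi.one_apply]
  have := Finset.card_le_card_of_injOn F (s := Finset.univ) (t := realChars D)
    (fun f _ => hFmem f) hFinj.injOn
  simpa only [Finset.card_univ, Fintype.card_fun, Fintype.card_coe, Fintype.card_units_int]
    using this

end QuadraticLOne

/-! ### The second moment through an auxiliary divisor. -/

namespace QuadraticLOne

open Complex Filter Topology

lemma mem_nonExceptional {c₀ : ℝ} {D : ℕ} [NeZero D] {χ : DirichletCharacter ℂ D} :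
    χ ∈ nonExceptional c₀ D ↔ IsQuadraticChar χ ∧ ¬ HasExceptionalZero c₀ χ := by
  simp [nonExceptional]

lemma nonExceptional_subset_realChars {c₀ : ℝ} {D : ℕ} [NeZero D] :
    nonExceptional c₀ D ⊆ realChars D := fun _ hχ =>
  mem_realChars.mpr (mem_nonExceptional.mp hχ).1.2

/-- Only the principal character and at most one exceptional character are missing. -/
lemma card_realChars_sdiff_le {c₀ : ℝ} (hc₀ : IsExceptionalConstant c₀) (D : ℕ) [NeZero D] :
    ((realChars D).filter fun χ => χ ∉ nonExceptional c₀ D).card ≤ 2 := by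
  classical
  have h1 : ((realChars D).filter fun χ => χ ∉ nonExceptional c₀ D) ⊆
      {1} ∪ (realChars D).filter fun χ => IsQuadraticChar χ ∧ HasExceptionalZero c₀ χ := by
    intro χ hχ
    rw [Finset.mem_filter, mem_nonExceptional] at hχ
    rw [Finset.mem_union, Finset.mem_singleton, Finset.mem_filter]
    by_cases h : χ = 1
    · exact Or.inl h
    · have hq : IsQuadraticChar χ := ⟨h, mem_realChars.mp hχ.1⟩
      refine Or.inr ⟨hχ.1, hq, ?_⟩
      by_contra hz
      exact hχ.2 ⟨hq, hz⟩
  have h2 : ((realChars D).filter fun χ =>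
      IsQuadraticChar χ ∧ HasExceptionalZero c₀ χ).card ≤ 1 := by
    rw [Finset.card_le_one]
    intro χ₁ h₁ χ₂ h₂
    rw [Finset.mem_filter] at h₁ h₂
    exact hc₀.2 D χ₁ χ₂ h₁.2.1 h₂.2.1 h₁.2.2 h₂.2.2
  refine (Finset.card_le_card h1).trans ((Finset.card_union_le _ _).trans ?_)
  rw [Finset.card_singleton]; omega

lemma card_realChars_le {c₀ : ℝ} (hc₀ : IsExceptionalConstant c₀) (D : ℕ) [NeZero D] :
    (realChars D).card ≤ (nonExceptional c₀ D).card + 2 := by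
  classical
  have h := Finset.card_filter_add_card_filter_not (s := realChars D)
    (fun χ => χ ∈ nonExceptional c₀ D)
  have h1 := card_realChars_sdiff_le hc₀ D
  have h2 : ((realChars D).filter fun χ => χ ∈ nonExceptional c₀ D) ⊆ nonExceptional c₀ D :=
    fun χ hχ => (Finset.mem_filter.mp hχ).2
  have := Finset.card_le_card h2
  omega

lemma sum_realChars_le {c₀ : ℝ} (hc₀ : IsExceptionalConstant c₀) {D : ℕ} [NeZero D]
    {f : DirichletCharacter ℂ D → ℝ} {a b : ℝ} (ha : 0 ≤ a) (hb0 : 0 ≤ b)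
    (hfa : ∀ χ ∈ nonExceptional c₀ D, f χ ≤ a) (hfb : ∀ χ ∈ realChars D, f χ ≤ b) :
    ∑ χ ∈ realChars D, f χ ≤ (realChars D).card * a + 2 * b := by
  classical
  calc ∑ χ ∈ realChars D, f χ
      ≤ ∑ χ ∈ realChars D, (a + if χ ∉ nonExceptional c₀ D then b else 0) := by
        refine Finset.sum_le_sum fun χ hχ => ?_
        split_ifs with h
        · linarith [hfa χ h]
        · linarith [hfb χ hχ]
    _ = (realChars D).card * a +
        ((realChars D).filter fun χ => χ ∉ nonExceptional c₀ D).card * b := by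
        rw [Finset.sum_add_distrib, ← Finset.sum_filter]
        simp
    _ ≤ _ := by
        gcongr
        exact_mod_cast card_realChars_sdiff_le hc₀ D

section Divisor

/-- The product `D'` of the odd primes `p ≤ Y` dividing `D` has many real characters. -/
lemma exists_odd_divisor (D : ℕ) [NeZero D] {Y : ℝ} (hY : Real.exp 1 ≤ Y) :
    ∃ D' : ℕ, ∃ _ : NeZero D', D' ∣ D ∧ 2 ^ omegaUpTo Y D ≤ 2 * (realChars D').card ∧
      (3 ≤ D' → Real.log (Real.log D') ≤
        Real.log (omegaUpTo Y D) + Real.log (Real.log Y)) := by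
  classical
  set T := D.primeFactors.filter fun p : ℕ => (p : ℝ) ≤ Y with hT
  -- The prime 2 supplies no sign, since -1 = 1 modulo 2; dropping it costs at most a factor 2 in
  -- the count.
  set S := T.erase 2 with hS
  have hω : omegaUpTo Y D = T.card := rfl
  have hSp : ∀ p ∈ S, p.Prime ∧ p ≠ 2 := fun p hp =>
    ⟨Nat.prime_of_mem_primeFactors (Finset.mem_filter.mp (Finset.mem_of_mem_erase hp)).1,
      Finset.ne_of_mem_erase hp⟩
  have hcard : T.card ≤ S.card + 1 := by
    have : T.card - 1 ≤ S.card := Finset.pred_card_le_card_erase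
    omega
  have hprod : ∏ i : S, (i : ℕ) = ∏ p ∈ S, p := Finset.prod_coe_sort S fun p => p
  have hne : (∏ i : S, (i : ℕ)) ≠ 0 := by
    rw [hprod]; exact Finset.prod_ne_zero_iff.mpr fun p hp => (hSp p hp).1.ne_zero
  refine ⟨∏ i : S, (i : ℕ), ⟨hne⟩, ?_, ?_, fun h3 => ?_⟩
  · rw [hprod]
    refine (Finset.prod_dvd_prod_of_subset _ _ _ ?_).trans (Nat.prod_primeFactors_dvd D)
    exact (Finset.erase_subset _ _).trans (Finset.filter_subset _ _)
  · have : NeZero (∏ i : S, (i : ℕ)) := ⟨hne⟩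
    have h1 := two_pow_card_le_card_realChars S hSp rfl
    calc 2 ^ omegaUpTo Y D ≤ 2 ^ (S.card + 1) := by
          rw [hω]; exact Nat.pow_le_pow_right (by norm_num) hcard
      _ = 2 * 2 ^ S.card := by ring
      _ ≤ _ := by gcongr
  · have hY1 : 1 ≤ Real.log Y := by
      rw [Real.le_log_iff_exp_le ((Real.exp_pos 1).trans_le hY)]; exact hY
    have hY0 : 1 ≤ Y := by linarith [Real.add_one_le_exp (1 : ℝ)]
    have hl := one_lt_log_of_three_le h3
    have hle : ((∏ i : S, (i : ℕ) : ℕ) : ℝ) ≤ Y ^ T.card := by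
      rw [hprod, Nat.cast_prod]
      calc ∏ p ∈ S, (p : ℝ) ≤ ∏ p ∈ S, Y := by
            refine Finset.prod_le_prod (fun _ _ => Nat.cast_nonneg _) fun p hp => ?_
            exact (Finset.mem_filter.mp (Finset.mem_of_mem_erase hp)).2
        _ = Y ^ S.card := Finset.prod_const _
        _ ≤ Y ^ T.card := pow_le_pow_right₀ hY0 (Finset.card_le_card (Finset.erase_subset _ _))
    have hlog := Real.log_le_log (by positivity) hle
    rw [Real.log_pow] at hlog
    have hT0 : (0 : ℝ) < T.card := by
      rcases Nat.eq_zero_or_pos T.card with h | h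
      · rw [h, Nat.cast_zero, zero_mul] at hlog; linarith
      · exact_mod_cast h
    rw [hω, ← Real.log_mul hT0.ne' (by linarith)]
    exact Real.log_le_log (by linarith) hlog

lemma two_pow_omegaUpTo_le (D : ℕ) [NeZero D] (Y : ℝ) : 2 ^ omegaUpTo Y D ≤ D := by
  calc 2 ^ omegaUpTo Y D ≤ 2 ^ D.primeFactors.card :=
        Nat.pow_le_pow_right (by norm_num) (Finset.card_le_card (Finset.filter_subset _ _))
    _ = ∏ p ∈ D.primeFactors, 2 := (Finset.prod_const _).symm
    _ ≤ ∏ p ∈ D.primeFactors, p :=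
        Finset.prod_le_prod' fun p hp => (Nat.prime_of_mem_primeFactors hp).two_le
    _ ≤ D := Nat.le_of_dvd (NeZero.pos D) (Nat.prod_primeFactors_dvd D)

end Divisor

/-- The quantity bounding the second moment of `log L(1, χ)`. -/
noncomputable def momentBound (Y : ℝ) (D : ℕ) : ℝ :=
  Real.log (Real.log D) * (Real.log (omegaUpTo Y D) + Real.log (Real.log Y)) +
    Real.log (Real.log D) ^ 2 / 2 ^ omegaUpTo Y D

/-- The second moment in a form with explicit error terms. -/
lemma exists_sum_log_LOne_sq_le {c₀ : ℝ} (hc₀ : IsExceptionalConstant c₀) :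
    ∃ C : ℝ, 0 ≤ C ∧ ∀ (D : ℕ) [NeZero D] (Y : ℝ), 3 ≤ D → Real.exp 1 ≤ Y →
      ∑ χ ∈ nonExceptional c₀ D, Real.log (LOne χ) ^ 2 ≤ (nonExceptional c₀ D).card *
        (6 * (Real.log (omegaUpTo Y D) + Real.log (Real.log Y) + C) ^ 2 +
          24 * (3 * Real.log (Real.log D) + C) ^ 2 / 2 ^ omegaUpTo Y D + 2) := by
  obtain ⟨ε, C₁, hε0, hε1, hC₁0, hC₁⟩ := exists_abs_logL_le hc₀.1
  obtain ⟨C₂, hC₂1, hC₂⟩ := exists_abs_logL_le_log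
  have hlog0 : 0 ≤ Real.log (C₂ / ε) := Real.log_nonneg (by rw [le_div_iff₀ hε0]; linarith)
  refine ⟨C₁ + Real.log (C₂ / ε), by positivity, fun D _ Y hD hY => ?_⟩
  set C := C₁ + Real.log (C₂ / ε) with hC
  set V := nonExceptional c₀ D with hV
  set ω := omegaUpTo Y D with hω
  rcases V.eq_empty_or_nonempty with hVe | hVne
  · rw [hVe]; simp
  have hV1 : (1 : ℝ) ≤ V.card := by exact_mod_cast hVne.card_pos
  have hl := one_lt_log_of_three_le hD
  obtain ⟨D', _, hdvd, hω2, hlogD'⟩ := exists_odd_divisor D hY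
  have hD'D : D' ≤ D := Nat.le_of_dvd (NeZero.pos D) hdvd
  set l := Real.log D with hldef
  set X := Real.log ω + Real.log (Real.log Y) with hX
  set L := Real.log l with hL
  have hL0 : 0 < L := Real.log_pos hl
  have hl0 : 0 < l := by linarith
  -- The same t is admissible modulo D', because D' ≤ D.
  set t := ε / l ^ 3 with ht
  have ht0 : 0 < t := by positivity
  have hl3 : 1 ≤ l ^ 3 := one_le_pow₀ hl.le
  have ht1 : t ≤ 1 := by rw [ht, div_le_one (by positivity)]; linarith
  have hbig : ∀ (M : ℕ) (χ : DirichletCharacter ℂ M), |logL χ (1 + t)| ≤ 3 * L + C :=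
    fun M χ => by
      have h1 := hC₂ M χ t ht0 ht1
      have h2 : C₂ / t = C₂ / ε * l ^ 3 := by rw [ht]; field_simp
      rw [h2, Real.log_mul (by positivity) (by positivity), Real.log_pow] at h1
      push_cast at h1
      linarith
  have hsmall : ∀ ψ ∈ nonExceptional c₀ D', |logL ψ (1 + t)| ≤ X + C := fun ψ hψ => by
    obtain ⟨hq, hz⟩ := mem_nonExceptional.mp hψ
    have h3 := three_le_of_ne_one hq.1
    have hl' := one_lt_log_of_three_le h3
    have h4 : Real.log D' ≤ l :=
      Real.log_le_log (by linarith [show (3 : ℝ) ≤ D' by exact_mod_cast h3])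
        (by exact_mod_cast hD'D)
    have h5 : t ≤ ε / Real.log D' ^ 3 := by
      have : 0 < Real.log D' := by linarith
      rw [ht]; gcongr
    have h6 := (hC₁ D' ψ hq hz t ht0 h5).2
    have h7 := hlogD' h3
    linarith
  have hsumD' : ∑ ψ ∈ realChars D', logL ψ (1 + t) ^ 2 ≤
      (realChars D').card * (X + C) ^ 2 + 2 * (3 * L + C) ^ 2 := by
    refine sum_realChars_le hc₀ (by positivity) (by positivity) (fun ψ hψ => ?_) fun ψ _ => ?_
    · rw [← sq_abs]; gcongr; exact hsmall ψ hψ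
    · rw [← sq_abs]; gcongr; exact hbig D' ψ
  have hsumD := card_mul_sum_logL_sq_le hdvd (show 1 < 1 + t by linarith)
  have hQ'0 : (0 : ℝ) < (realChars D').card := by
    exact_mod_cast Finset.card_pos.mpr ⟨1, one_mem_realChars⟩
  have hQ' : (2 : ℝ) ^ ω ≤ 2 * (realChars D').card := by exact_mod_cast hω2
  -- As `V` is nonempty, the two extra characters are absorbed into the factor 3.
  have hQ : ((realChars D).card : ℝ) ≤ 3 * V.card := by
    have : ((realChars D).card : ℝ) ≤ V.card + 2 := by exact_mod_cast card_realChars_le hc₀ D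
    linarith
  have hmean : ∑ χ ∈ realChars D, logL χ (1 + t) ^ 2 ≤
      3 * V.card * ((X + C) ^ 2 + 4 * (3 * L + C) ^ 2 / 2 ^ ω) := by
    have h1 : ∑ χ ∈ realChars D, logL χ (1 + t) ^ 2 ≤
        (realChars D).card * ((X + C) ^ 2 + 2 * (3 * L + C) ^ 2 / (realChars D').card) := by
      rw [← mul_le_mul_iff_right₀ hQ'0]
      refine hsumD.trans ((mul_le_mul_of_nonneg_left hsumD' (Nat.cast_nonneg _)).trans_eq ?_)
      field_simp
    refine h1.trans (mul_le_mul hQ (add_le_add_right ?_ _) (by positivity) (by positivity))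
    rw [div_le_div_iff₀ hQ'0 (by positivity)]
    nlinarith [sq_nonneg (3 * L + C)]
  calc ∑ χ ∈ V, Real.log (LOne χ) ^ 2
      ≤ ∑ χ ∈ V, (2 * logL χ (1 + t) ^ 2 + 2) := by
        refine Finset.sum_le_sum fun χ hχ => ?_
        obtain ⟨hq, hz⟩ := mem_nonExceptional.mp hχ
        have h1 := abs_le.mp (hC₁ D χ hq hz t ht0 le_rfl).1
        -- With a = log L(1+t,χ) and b = log L(1,χ), 2a² + 2(a-b)² - b² = (2a-b)².
        nlinarith [sq_nonneg (2 * logL χ (1 + t) - Real.log (LOne χ))]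
    _ = 2 * ∑ χ ∈ V, logL χ (1 + t) ^ 2 + 2 * V.card := by
        rw [Finset.sum_add_distrib, Finset.mul_sum]; simp; ring
    _ ≤ 2 * ∑ χ ∈ realChars D, logL χ (1 + t) ^ 2 + 2 * V.card := by
        gcongr
        exact nonExceptional_subset_realChars
    _ ≤ 2 * (3 * V.card * ((X + C) ^ 2 + 4 * (3 * L + C) ^ 2 / 2 ^ ω)) + 2 * V.card := by
        gcongr
    _ = _ := by ring

end QuadraticLOne

/-! ### Absorbing the error terms, and Chebyshev's inequality. -/

namespace QuadraticLOne

open Complex Filter Topology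

lemma log_log_three_pos : 0 < Real.log (Real.log 3) :=
  Real.log_pos (by simpa using one_lt_log_of_three_le (le_refl 3))

lemma log_log_three_le {D : ℕ} (hD : 3 ≤ D) :
    Real.log (Real.log 3) ≤ Real.log (Real.log D) := by
  have h3 : (0 : ℝ) < Real.log 3 := Real.log_pos (by norm_num)
  have hD' : (3 : ℝ) ≤ D := by exact_mod_cast hD
  exact Real.log_le_log h3 (Real.log_le_log (by norm_num) hD')

section

variable {D : ℕ} {Y : ℝ}

lemma log_omega_add_nonneg (hY : Real.exp 1 ≤ Y) :
    0 ≤ Real.log (omegaUpTo Y D) + Real.log (Real.log Y) := by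
  have hY1 : 1 ≤ Real.log Y := by
    rw [Real.le_log_iff_exp_le ((Real.exp_pos 1).trans_le hY)]; exact hY
  exact add_nonneg (Real.log_natCast_nonneg _) (Real.log_nonneg hY1)

variable [NeZero D]

/-- From 2^ω ≤ D one gets ω ≤ 2 log D. This is what allows X² to be replaced by a multiple of X log
log D. -/
lemma log_omega_add_le (hD : 3 ≤ D) (hY : Real.exp 1 ≤ Y) (hYD : Y ≤ D) :
    Real.log (omegaUpTo Y D) + Real.log (Real.log Y) ≤
      2 * Real.log (Real.log D) + Real.log 2 := by
  have hl := one_lt_log_of_three_le hD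
  have hY0 : 0 < Y := (Real.exp_pos 1).trans_le hY
  have hY1 : 1 ≤ Real.log Y := by rw [Real.le_log_iff_exp_le hY0]; exact hY
  have h1 : Real.log (Real.log Y) ≤ Real.log (Real.log D) :=
    Real.log_le_log (by linarith) (Real.log_le_log hY0 hYD)
  have h2 : Real.log (omegaUpTo Y D) ≤ Real.log 2 + Real.log (Real.log D) := by
    rcases Nat.eq_zero_or_pos (omegaUpTo Y D) with h | h
    · rw [h, Nat.cast_zero, Real.log_zero]
      have := Real.log_pos one_lt_two
      have := Real.log_pos hl
      linarith
    · rw [← Real.log_mul (by norm_num) (by linarith)]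
      refine Real.log_le_log (by exact_mod_cast h) ?_
      have h3 : ((2 : ℝ) ^ omegaUpTo Y D) ≤ D := by exact_mod_cast two_pow_omegaUpTo_le D Y
      have h4 := Real.log_le_log (by positivity) h3
      rw [Real.log_pow] at h4
      have h5 := Real.log_two_gt_d9
      have h6 : (0 : ℝ) ≤ omegaUpTo Y D := by positivity
      nlinarith
  linarith

/-- Allows additive constants to be absorbed. For ω ≤ 1 the term with 2^ω is bounded below; for ω ≥
2 the term with log ω is. -/
lemma exists_le_momentBound : ∃ c : ℝ, 0 < c ∧ ∀ (D : ℕ) [NeZero D] (Y : ℝ), 3 ≤ D →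
    Real.exp 1 ≤ Y → c ≤ momentBound Y D := by
  have h0 := log_log_three_pos
  refine ⟨min (Real.log (Real.log 3) ^ 2 / 2) (Real.log (Real.log 3) * Real.log 2),
    lt_min (by positivity) (mul_pos h0 (Real.log_pos one_lt_two)), fun D _ Y hD hY => ?_⟩
  have hL := log_log_three_le hD
  have hX := log_omega_add_nonneg (D := D) hY
  have hL0 := h0.trans_le hL
  rw [momentBound]
  rcases Nat.lt_or_ge (omegaUpTo Y D) 2 with h | h
  · refine (min_le_left _ _).trans ?_
    have h1 : (2 : ℝ) ^ omegaUpTo Y D ≤ 2 := by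
      calc (2 : ℝ) ^ omegaUpTo Y D ≤ 2 ^ 1 := pow_le_pow_right₀ (by norm_num) (by omega)
        _ = 2 := pow_one 2
    have h2 : Real.log (Real.log 3) ^ 2 / 2 ≤
        Real.log (Real.log D) ^ 2 / 2 ^ omegaUpTo Y D := by gcongr
    have := mul_nonneg hL0.le hX
    linarith
  · refine (min_le_right _ _).trans ?_
    have hY1 : 1 ≤ Real.log Y := by
      rw [Real.le_log_iff_exp_le ((Real.exp_pos 1).trans_le hY)]; exact hY
    have h1 : Real.log 2 ≤ Real.log (omegaUpTo Y D) + Real.log (Real.log Y) := by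
      have := Real.log_le_log two_pos (show (2 : ℝ) ≤ omegaUpTo Y D by exact_mod_cast h)
      linarith [Real.log_nonneg hY1]
    have h2 := mul_le_mul hL h1 (Real.log_pos one_lt_two).le hL0.le
    have h3 : 0 ≤ Real.log (Real.log D) ^ 2 / 2 ^ omegaUpTo Y D := by positivity
    linarith

end

/-- The second moment of `log L(1, χ)` over the non-exceptional quadratic characters. -/
theorem exists_sum_log_LOne_sq_le_momentBound {c₀ : ℝ} (hc₀ : IsExceptionalConstant c₀) :
    ∃ C : ℝ, 0 < C ∧ ∀ (D : ℕ) [NeZero D] (Y : ℝ), 3 ≤ D → Real.exp 1 ≤ Y → Y ≤ D →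
      ∑ χ ∈ nonExceptional c₀ D, Real.log (LOne χ) ^ 2 ≤
        (nonExceptional c₀ D).card * (C * momentBound Y D) := by
  obtain ⟨C₁, hC₁0, hC₁⟩ := exists_sum_log_LOne_sq_le hc₀
  obtain ⟨c, hc0, hc⟩ := exists_le_momentBound
  have hL₀ := log_log_three_pos
  set L₀ := Real.log (Real.log 3)
  have hlog2 := Real.log_pos one_lt_two
  refine ⟨12 * (2 + Real.log 2 / L₀) + 24 * (3 + C₁ / L₀) ^ 2 + (12 * C₁ ^ 2 + 2) / c,
    by positivity, fun D _ Y hD hY hYD => (hC₁ D Y hD hY).trans ?_⟩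
  have hb := hc D Y hD hY
  have hL := log_log_three_le hD
  have hX0 := log_omega_add_nonneg (D := D) hY
  have hX1 := log_omega_add_le hD hY hYD
  have hLeq : momentBound Y D = Real.log (Real.log D) *
      (Real.log (omegaUpTo Y D) + Real.log (Real.log Y)) +
      Real.log (Real.log D) ^ 2 / 2 ^ omegaUpTo Y D := rfl
  set X := Real.log (omegaUpTo Y D) + Real.log (Real.log Y)
  set L := Real.log (Real.log D)
  set ω := omegaUpTo Y D
  set R := momentBound Y D
  have hL0 : 0 < L := hL₀.trans_le hL
  have hR0 : 0 < R := hc0.trans_le hb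
  have hLX : L * X ≤ R := by
    have : 0 ≤ L ^ 2 / 2 ^ ω := by positivity
    linarith
  have hLω : L ^ 2 / 2 ^ ω ≤ R := by
    have := mul_nonneg hL0.le hX0
    linarith
  -- Since log log D ≥ log log 3 > 0, a constant is at most a multiple of log log D.
  have hscale : ∀ a : ℝ, 0 ≤ a → a ≤ a / L₀ * L := fun a ha => by
    calc a = a / L₀ * L₀ := by field_simp
      _ ≤ _ := by gcongr
  have h1 : 6 * (X + C₁) ^ 2 ≤ 12 * (2 + Real.log 2 / L₀) * R + 12 * C₁ ^ 2 := by
    have h2 : X ≤ (2 + Real.log 2 / L₀) * L := by linarith [hscale _ hlog2.le]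
    have h3 : X ^ 2 ≤ (2 + Real.log 2 / L₀) * R := by
      calc X ^ 2 = X * X := sq X
        _ ≤ (2 + Real.log 2 / L₀) * L * X := by gcongr
        _ = (2 + Real.log 2 / L₀) * (L * X) := by ring
        _ ≤ _ := by gcongr
    nlinarith [sq_nonneg (X - C₁)]
  have h2 : 24 * (3 * L + C₁) ^ 2 / 2 ^ ω ≤ 24 * (3 + C₁ / L₀) ^ 2 * R := by
    calc 24 * (3 * L + C₁) ^ 2 / 2 ^ ω ≤ 24 * ((3 + C₁ / L₀) * L) ^ 2 / 2 ^ ω := by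
          gcongr
          linarith [hscale _ hC₁0]
      _ = 24 * (3 + C₁ / L₀) ^ 2 * (L ^ 2 / 2 ^ ω) := by ring
      _ ≤ _ := by gcongr
  have h3 : 12 * C₁ ^ 2 + 2 ≤ (12 * C₁ ^ 2 + 2) / c * R := by
    calc 12 * C₁ ^ 2 + 2 = (12 * C₁ ^ 2 + 2) / c * c := by field_simp
      _ ≤ _ := by gcongr
  gcongr
  linarith

lemma three_le_of_exp_one_le {D : ℕ} {Y : ℝ} (hY : Real.exp 1 ≤ Y) (hYD : Y ≤ D) : 3 ≤ D := by
  have h1 := Real.exp_one_gt_d9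
  have h2 : ((2 : ℕ) : ℝ) < D := by push_cast; linarith
  exact_mod_cast h2

/-- Chebyshev's inequality for a second moment over a finite set. -/
lemma le_card_filter_of_sum_sq_le {ι : Type*} (V : Finset ι) (g : ι → ℝ) (p : ι → Prop)
    [DecidablePred p] {k R : ℝ} (hk : 0 < k) (hR : 0 < R)
    (hsum : ∑ χ ∈ V, g χ ^ 2 ≤ V.card * R) (hp : ∀ χ ∈ V, ¬ p χ → k ^ 2 * R ≤ g χ ^ 2) :
    (1 - 1 / k ^ 2) * (V.card : ℝ) ≤ ((V.filter p).card : ℝ) := by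
  have h1 : ((V.filter fun χ => ¬ p χ).card : ℝ) * (k ^ 2 * R) ≤ V.card * R := by
    calc _ = ∑ χ ∈ V.filter fun χ => ¬ p χ, k ^ 2 * R := by simp
      _ ≤ ∑ χ ∈ V.filter fun χ => ¬ p χ, g χ ^ 2 := Finset.sum_le_sum fun χ hχ =>
          hp χ (Finset.mem_filter.mp hχ).1 (Finset.mem_filter.mp hχ).2
      _ ≤ ∑ χ ∈ V, g χ ^ 2 :=
          Finset.sum_le_sum_of_subset_of_nonneg (Finset.filter_subset _ _)
            fun _ _ _ => sq_nonneg _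
      _ ≤ _ := hsum
  have h2 : ((V.filter p).card : ℝ) + ((V.filter fun χ => ¬ p χ).card : ℝ) = V.card := by
    exact_mod_cast Finset.card_filter_add_card_filter_not (s := V) p
  have h3 : ((V.filter fun χ => ¬ p χ).card : ℝ) ≤ V.card / k ^ 2 := by
    rw [le_div_iff₀ (by positivity)]
    refine le_of_mul_le_mul_right ?_ hR
    linarith
  have h4 : (1 - 1 / k ^ 2) * (V.card : ℝ) = V.card - V.card / k ^ 2 := by ring
  linarith

end QuadraticLOne

theorem lemma3p2 :
    -- an admissible constant in the definition of exceptional zeros exists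
    (∃ c₀ : ℝ, QuadraticLOne.IsExceptionalConstant c₀) ∧
    -- `L(1, χ)` is a positive real number, so that `log L(1, χ)` is a genuine real logarithm
    (∀ (D : ℕ) [NeZero D] (χ : DirichletCharacter ℂ D), QuadraticLOne.IsQuadraticChar χ →
      χ.LFunction 1 = ((QuadraticLOne.LOne χ : ℝ) : ℂ) ∧ 0 < QuadraticLOne.LOne χ) ∧
    ∀ c₀ : ℝ, QuadraticLOne.IsExceptionalConstant c₀ →
      -- the second moment bound
      (∃ C : ℝ, 0 < C ∧ ∀ (D : ℕ) [NeZero D] (Y : ℝ), Real.exp 1 ≤ Y → Y < (D : ℝ) →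
        1 / ((QuadraticLOne.nonExceptional c₀ D).card : ℝ) *
            ∑ χ ∈ QuadraticLOne.nonExceptional c₀ D, Real.log (QuadraticLOne.LOne χ) ^ 2
          ≤ C * (Real.log (Real.log D) *
                (Real.log (QuadraticLOne.omegaUpTo Y D) + Real.log (Real.log Y)) +
              Real.log (Real.log D) ^ 2 / 2 ^ QuadraticLOne.omegaUpTo Y D)) ∧
      -- the lower bound for a proportion at least `1 - 1 / k ^ 2` of the characters
      (∃ c : ℝ, 0 < c ∧ ∀ (D : ℕ) [NeZero D] (Y k : ℝ), Real.exp 1 ≤ Y → Y ≤ (D : ℝ) → 1 ≤ k →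
        (1 - 1 / k ^ 2) * ((QuadraticLOne.nonExceptional c₀ D).card : ℝ) ≤
          (((QuadraticLOne.nonExceptional c₀ D).filter fun χ =>
            Real.log D ^ (-(k * c * √((Real.log (QuadraticLOne.omegaUpTo Y D) +
                Real.log (Real.log Y)) / Real.log (Real.log D) +
                1 / 2 ^ QuadraticLOne.omegaUpTo Y D))) ≤
              QuadraticLOne.LOne χ).card : ℝ)) := by
  refine ⟨QuadraticLOne.exists_isExceptionalConstant, fun D _ χ hχ =>
    ⟨QuadraticLOne.LFunction_one_eq_LOne hχ, QuadraticLOne.LOne_pos hχ⟩, fun c₀ hc₀ => ?_⟩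
  obtain ⟨C, hC0, hC⟩ := QuadraticLOne.exists_sum_log_LOne_sq_le_momentBound hc₀
  refine ⟨⟨C, hC0, fun D _ Y hY hYD => ?_⟩, ⟨√C, Real.sqrt_pos.mpr hC0,
    fun D _ Y k hY hYD hk => ?_⟩⟩
  · have hD := QuadraticLOne.three_le_of_exp_one_le hY hYD.le
    obtain ⟨c, hc, hb⟩ := QuadraticLOne.exists_le_momentBound
    -- Nonnegativity covers empty `V`, where the left side is 0 because 1/0 = 0.
    have hb0 : 0 ≤ C * QuadraticLOne.momentBound Y D :=
      mul_nonneg hC0.le (hc.le.trans (hb D Y hD hY))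
    rw [one_div]
    exact inv_mul_le_of_le_mul₀ (Nat.cast_nonneg _) hb0 (hC D Y hD hY hYD.le)
  · have hD := QuadraticLOne.three_le_of_exp_one_le hY hYD
    obtain ⟨c, hc, hb⟩ := QuadraticLOne.exists_le_momentBound
    have hb0 := hc.trans_le (hb D Y hD hY)
    have hl := QuadraticLOne.one_lt_log_of_three_le hD
    have hL0 : 0 < Real.log (Real.log D) := Real.log_pos hl
    refine QuadraticLOne.le_card_filter_of_sum_sq_le _
      (fun χ => Real.log (QuadraticLOne.LOne χ)) _ (by linarith) (mul_pos hC0 hb0)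
      (hC D Y hD hY hYD) fun χ hχ hlt => ?_
    rw [not_le, Real.rpow_def_of_pos (by linarith)] at hlt
    have hpos := QuadraticLOne.LOne_pos (QuadraticLOne.mem_nonExceptional.mp hχ).1
    have h1 := Real.log_lt_log hpos hlt
    rw [Real.log_exp] at h1
    -- Taking logarithms turns the exponent, with c = √C, into the Chebyshev threshold k√(C ·
    -- `momentBound`).
    have h2 : √((Real.log (QuadraticLOne.omegaUpTo Y D) + Real.log (Real.log Y)) /
        Real.log (Real.log D) + 1 / 2 ^ QuadraticLOne.omegaUpTo Y D) * Real.log (Real.log D) =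
        √(QuadraticLOne.momentBound Y D) := by
      rw [← Real.sqrt_sq hL0.le, ← Real.sqrt_mul' _ (sq_nonneg _), Real.sqrt_sq hL0.le,
        QuadraticLOne.momentBound]
      congr 1
      field_simp
    have h3 : k * (√C * √(QuadraticLOne.momentBound Y D)) ≤
        -Real.log (QuadraticLOne.LOne χ) := by
      rw [← h2]; linarith
    have h4 : (k * (√C * √(QuadraticLOne.momentBound Y D))) ^ 2 =
        k ^ 2 * (C * QuadraticLOne.momentBound Y D) := by
      rw [mul_pow, mul_pow, Real.sq_sqrt hC0.le, Real.sq_sqrt hb0.le]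
    rw [← h4, ← neg_sq (Real.log _)]
    gcongr
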